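/- **Setting.** Let $(W,S)$ be a Coxeter group with $S$ finite; for $J\subseteq S$ let $W_J=\langle J\rangle$. Graphs are graphs in the sense of Serre, with oriented edges, origin $o$, terminus $t$ and edge inversion $e\mapsto\bar e$. A *graph of special subgroups* $(\mathcal G,\Lambda)$ of $(W,S)$ over a connected graph $\Lambda$ is given by subsets $S_\lambda\subseteq S$, one for each vertex and edge $\lambda$ of $\Lambda$, with $S_{\bar e}=S_e\subseteq S_{t(e)}$; its groups are $\mathcal G_\lambda=W_{S_\lambda}$ and its monomorphisms $\mathcal G_e\to\mathcal G_{t(e)}$ are the inclusions. It is a *visual graph of groups decomposition* of $(W,S)$ if the homomorphism $\pi_1(\mathcal G,\Lambda)\to W$ induced by the inclusions of the vertex groups (and trivial on the edges of $\Lambda$) is an isomorphism. Here $\pi_1(\mathcal G,\Lambda)$ is the fundamental group of the graph of groups, taken with respect to a maximal subtree of $\Lambda$. Let $\Delta=(\mathcal C,\delta)$ be a building of type $(W,S)$. For $J\subseteq S$ and $c\in\mathcal C$ put $\mathrm{Res}_J(c)=\{d\in\mathcal C\mid\delta(c,d)\in W_J\}$. The *residue graph* $\Gamma=\Gamma^\Delta_{(\mathcal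 G,\Lambda)}(\mathcal C)$ has vertex set $\bigsqcup_{v}\{\mathrm{Res}_{S_v}(c)\mid c\in\mathcal C\}$, $v$ ranging over the vertices of $\Lambda$, and edge set $\bigsqcup_{e}\{\mathrm{Res}_{S_e}(c)\mid c\in\mathcal C\}$, $e$ ranging over the edges of $\Lambda$, with $$o(\mathrm{Res}_{S_e}(c))=\mathrm{Res}_{S_{o(e)}}(c),\qquad t(\mathrm{Res}_{S_e}(c))=\mathrm{Res}_{S_{t(e)}}(c),\qquad \overline{\mathrm{Res}_{S_e}(c)}=\mathrm{Res}_{S_{\bar e}}(c).$$ A topological group $G$ *acts on* $\Delta$ if it is given a continuous homomorphism from $G$ to the group of bijections of $\mathcal C$ preserving $\delta$, endowed with the permutation topology (the pointwise stabilisers of finite sets of chambers form a neighbourhood basis of the identity). **Corollary G.** Let $G$ be a $\sigma$-compact totally disconnected locally compact (t.d.l.c.) group acting on a building $\Delta=(\mathcal C,\delta)$ of type $(W,S)$ transitively on the set $\mathcal C$ of chambers, let $c\in\mathcal C$, and let $(\mathcal G,\Lambda)$ be a visual graph of groups decomposition of $(W,S)$. For each vertex or edge $\lambda$ of $\Lambda$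 let $\widetilde{\mathcal G}_\lambda$ be the setwise stabiliser of $\mathrm{Res}_{S_\lambda}(c)$ in $G$. Then: 1. $\Lambda$ is a tree, and the groups $\widetilde{\mathcal G}_\lambda$ with the inclusions $\widetilde{\mathcal G}_e\hookrightarrow\widetilde{\mathcal G}_{t(e)}$ form a tree of t.d.l.c. groups $(\widetilde{\mathcal G},\Lambda)$, i.e. all $\widetilde{\mathcal G}_\lambda$ are t.d.l.c. and the inclusions are continuous and open. 2. The topology on $\pi_1(\widetilde{\mathcal G},\Lambda)$ generated by the left cosets of the open subgroups of the vertex groups makes it a topological group in which these open subgroups form a neighbourhood basis of the identity. The homomorphism $\varphi\colon\pi_1(\widetilde{\mathcal G},\Lambda)\to G$ induced by the inclusions $\widetilde{\mathcal G}_v\hookrightarrow G$ is an isomorphism of topological groups. 3. The universal Bass–Serre graph of $(\widetilde{\mathcal G},\Lambda)$, whose vertices and edges are the left cosets in $\pi_1(\widetilde{\mathcal G},\Lambda)$ of the vertex and edge groups, is a tree, and it is isomorphic to the residue graph $\Gamma$ through $g\,\widetilde{\mathcal G}_\lambda\mapsto\mathrm{Res}_{S_\lambda}(\varphi(g)\cdot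 c)$. -/

import Mathlib

open scoped Topology

universe u v w

/-! ### Graphs in the sense of Serre -/

/-- A graph in the sense of Serre: vertices, oriented edges, origin, terminus and a fixed-point
free edge inversion. -/
structure SerreGraph where
  V : Type u
  E : Type v
  o : E → V
  t : E → V
  inv : E → E
  inv_inv : ∀ e, inv (inv e) = e
  inv_ne : ∀ e, inv e ≠ e
  o_inv : ∀ e, o (inv e) = t e

namespace SerreGraph

variable (X : SerreGraph.{u, v})

theorem t_inv (e : X.E) : X.t (X.inv e) = X.o e := by
  rw [← X.o_inv, X.inv_inv]

/-- `X.IsPath a p b`: the list of edges `p` is a path from `a` to `b`. -/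
def IsPath : X.V → List X.E → X.V → Prop
  | a, [], b => a = b
  | a, e :: p, b => X.o e = a ∧ IsPath (X.t e) p b

/-- A path without backtracking. -/
def IsReduced (p : List X.E) : Prop :=
  p.IsChain fun e f => f ≠ X.inv e

/-- Connected (and non-empty). -/
def IsConnected : Prop :=
  Nonempty X.V ∧ ∀ a b, ∃ p, X.IsPath a p b

/-- A tree: a connected non-empty graph with no closed path without backtracking of positive
length. -/
def IsTree : Prop :=
  X.IsConnected ∧ ∀ a p, X.IsPath a p a → X.IsReduced p → p = []

/-- The subgraph with all the vertices and with edge set `T`. -/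
def spanningSubgraph (T : Set X.E) (hT : ∀ e ∈ T, X.inv e ∈ T) : SerreGraph.{u, v} where
  V := X.V
  E := T
  o e := X.o e
  t e := X.t e
  inv e := ⟨X.inv e, hT e e.2⟩
  inv_inv e := Subtype.ext (X.inv_inv e)
  inv_ne e h := X.inv_ne e (congrArg Subtype.val h)
  o_inv e := X.o_inv e

/-- `T` is the edge set of a maximal subtree (in a connected graph, a maximal subtree is the same
as a subtree containing all the vertices). -/
def IsMaximalTree (T : Set X.E) : Prop :=
  ∃ hT : ∀ e ∈ T, X.inv e ∈ T, (X.spanningSubgraph T hT).IsTree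

/-- Isomorphisms of graphs. -/
structure Iso (X : SerreGraph) (Y : SerreGraph) where
  onV : X.V ≃ Y.V
  onE : X.E ≃ Y.E
  map_o : ∀ e, onV (X.o e) = Y.o (onE e)
  map_t : ∀ e, onV (X.t e) = Y.t (onE e)
  map_inv : ∀ e, onE (X.inv e) = Y.inv (onE e)

end SerreGraph

/-! ### Graphs of groups

All graphs of groups below consist of subgroups of one ambient group, and the monomorphisms
from the edge groups to the vertex groups are inclusions. -/

/-- A graph of groups based on `Λ` whose vertex and edge groups are subgroups of `H` and whose
monomorphisms `edge e → vert (t e)` are the inclusions. -/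
structure GraphOfSubgroups (Λ : SerreGraph.{u, v}) (H : Type w) [Group H] where
  vert : Λ.V → Subgroup H
  edge : Λ.E → Subgroup H
  edge_inv : ∀ e, edge (Λ.inv e) = edge e
  edge_le : ∀ e, edge e ≤ vert (Λ.t e)

namespace GraphOfSubgroups

variable {Λ : SerreGraph.{u, v}} {H : Type w} [Group H] (𝒢 : GraphOfSubgroups Λ H)

theorem edge_le_o (e : Λ.E) : 𝒢.edge e ≤ 𝒢.vert (Λ.o e) := by
  have h := 𝒢.edge_le (Λ.inv e)
  rwa [𝒢.edge_inv, Λ.t_inv] at h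

/-- The free product of all the vertex groups and of the free group on the edges. -/
abbrev PreGroup : Type _ :=
  Monoid.Coprod (Monoid.CoprodI fun x => 𝒢.vert x) (FreeGroup Λ.E)

/-- A vertex group in the free product. -/
def preVert (x : Λ.V) : 𝒢.vert x →* 𝒢.PreGroup :=
  Monoid.Coprod.inl.comp (Monoid.CoprodI.of (M := fun x => 𝒢.vert x) (i := x))

/-- An edge as an element of the free product. -/
def preEdge (e : Λ.E) : 𝒢.PreGroup :=
  Monoid.Coprod.inr (FreeGroup.of e)

/-- The relators of the fundamental group with respect to a maximal tree `T`:
`e * ē = 1`, `e * a * e⁻¹ = a` for `a` in the edge group of `e`, where the `a` on the left is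
taken in the vertex group of `t e` and that on the right in the vertex group of `o e`, and `e = 1`
for `e ∈ T`. -/
inductive Relator (T : Set Λ.E) : 𝒢.PreGroup → Prop
  | inv (e : Λ.E) : Relator T (𝒢.preEdge e * 𝒢.preEdge (Λ.inv e))
  | conj (e : Λ.E) (a : 𝒢.edge e) :
      Relator T (𝒢.preEdge e * 𝒢.preVert (Λ.t e) (Subgroup.inclusion (𝒢.edge_le e) a) *
        (𝒢.preEdge e)⁻¹ * (𝒢.preVert (Λ.o e) (Subgroup.inclusion (𝒢.edge_le_o e) a))⁻¹)
  | tree (e : Λ.E) (he : e ∈ T) : Relator T (𝒢.preEdge e)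

/-- The fundamental group `π₁(𝒢, Λ, T)` of a graph of groups with respect to a maximal
tree `T`. -/
def Pi1 (T : Set Λ.E) : Type _ :=
  𝒢.PreGroup ⧸ Subgroup.normalClosure {r | 𝒢.Relator T r}

variable (T : Set Λ.E)

instance : Group (𝒢.Pi1 T) :=
  inferInstanceAs (Group (𝒢.PreGroup ⧸ Subgroup.normalClosure {r | 𝒢.Relator T r}))

/-- The quotient map onto the fundamental group. -/
def toPi1 : 𝒢.PreGroup →* 𝒢.Pi1 T :=
  QuotientGroup.mk' (Subgroup.normalClosure {r | 𝒢.Relator T r})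

/-- The canonical map from a vertex group to the fundamental group. -/
def ofVert (x : Λ.V) : 𝒢.vert x →* 𝒢.Pi1 T :=
  (𝒢.toPi1 T).comp (𝒢.preVert x)

/-- The element of the fundamental group given by an edge. -/
def ofEdge (e : Λ.E) : 𝒢.Pi1 T :=
  𝒢.toPi1 T (𝒢.preEdge e)

theorem toPi1_relator {r : 𝒢.PreGroup} (h : 𝒢.Relator T r) : 𝒢.toPi1 T r = 1 :=
  (QuotientGroup.eq_one_iff r).2 (Subgroup.subset_normalClosure h)

theorem ofEdge_inv (e : Λ.E) : 𝒢.ofEdge T (Λ.inv e) = (𝒢.ofEdge T e)⁻¹ := by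
  have h := 𝒢.toPi1_relator T (.inv e)
  rw [map_mul] at h
  exact eq_inv_of_mul_eq_one_right h

theorem ofEdge_conj (e : Λ.E) (a : 𝒢.edge e) :
    𝒢.ofEdge T e * 𝒢.ofVert T (Λ.t e) (Subgroup.inclusion (𝒢.edge_le e) a) *
      (𝒢.ofEdge T e)⁻¹ = 𝒢.ofVert T (Λ.o e) (Subgroup.inclusion (𝒢.edge_le_o e) a) := by
  have h := 𝒢.toPi1_relator T (.conj e a)
  rw [map_mul, map_mul, map_mul, map_inv, map_inv] at h
  exact mul_inv_eq_one.1 h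

/-- The homomorphism from the free product to the ambient group that is the inclusion on every
vertex group and sends every edge to `1`. -/
def preToAmbient : 𝒢.PreGroup →* H :=
  Monoid.Coprod.lift (Monoid.CoprodI.lift fun x => (𝒢.vert x).subtype) 1

theorem preToAmbient_relator {r : 𝒢.PreGroup} (h : 𝒢.Relator T r) :
    𝒢.preToAmbient r = 1 := by
  cases h <;> simp [preToAmbient, preEdge, preVert]

/-- The homomorphism from the fundamental group to the ambient group induced by the inclusions
of the vertex groups (and sending every edge to `1`). -/
def toAmbient : 𝒢.Pi1 T →* H :=
  QuotientGroup.lift (Subgroup.normalClosure {r | 𝒢.Relator T r}) 𝒢.preToAmbient fun _ h =>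
    (Subgroup.normalClosure_le_normal (N := 𝒢.preToAmbient.ker)
      fun _ hr => 𝒢.preToAmbient_relator T hr) h

/-! #### The universal Bass–Serre graph -/

/-- The image of a vertex group in the fundamental group. -/
def vertImage (x : Λ.V) : Subgroup (𝒢.Pi1 T) :=
  (𝒢.ofVert T x).range

/-- The image of the edge group of `e` in the fundamental group, through the vertex group of
the terminus of `e`. -/
def edgeImage (e : Λ.E) : Subgroup (𝒢.Pi1 T) :=
  ((𝒢.ofVert T (Λ.t e)).comp (Subgroup.inclusion (𝒢.edge_le e))).range

theorem edgeImage_le (e : Λ.E) : 𝒢.edgeImage T e ≤ 𝒢.vertImage T (Λ.t e) := by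
  rintro _ ⟨a, rfl⟩
  exact ⟨_, rfl⟩

theorem ofVert_congr {x y : Λ.V} (h : x = y) (a : H) (hx : a ∈ 𝒢.vert x) (hy : a ∈ 𝒢.vert y) :
    𝒢.ofVert T x ⟨a, hx⟩ = 𝒢.ofVert T y ⟨a, hy⟩ := by
  subst h; rfl

theorem conj_mem_edgeImage (e : Λ.E) {h : 𝒢.Pi1 T} (hh : h ∈ 𝒢.edgeImage T e) :
    𝒢.ofEdge T e * h * (𝒢.ofEdge T e)⁻¹ ∈ 𝒢.edgeImage T (Λ.inv e) := by
  obtain ⟨a, rfl⟩ := hh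
  refine ⟨⟨a, by rw [𝒢.edge_inv]; exact a.2⟩, ?_⟩
  exact (𝒢.ofVert_congr T (Λ.t_inv e) _ _ _).trans (𝒢.ofEdge_conj T e a).symm

theorem conj_mem_vertImage (e : Λ.E) {h : 𝒢.Pi1 T} (hh : h ∈ 𝒢.edgeImage T e) :
    𝒢.ofEdge T e * h * (𝒢.ofEdge T e)⁻¹ ∈ 𝒢.vertImage T (Λ.o e) := by
  obtain ⟨a, rfl⟩ := hh
  exact ⟨_, (𝒢.ofEdge_conj T e a).symm⟩

/-- The map `g ↦ g * e⁻¹` on cosets. -/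
def cosetShift (e : Λ.E) (K : Subgroup (𝒢.Pi1 T))
    (hK : ∀ h ∈ 𝒢.edgeImage T e, 𝒢.ofEdge T e * h * (𝒢.ofEdge T e)⁻¹ ∈ K) :
    𝒢.Pi1 T ⧸ 𝒢.edgeImage T e → 𝒢.Pi1 T ⧸ K :=
  Quotient.map' (fun g => g * (𝒢.ofEdge T e)⁻¹) fun g g' h => by
    rw [QuotientGroup.leftRel_apply] at h ⊢
    simpa [mul_assoc] using hK _ h

theorem sigma_mk_eq {ι : Type*} (K : ι → Subgroup (𝒢.Pi1 T)) {i j : ι} (hij : i = j)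
    {g g' : 𝒢.Pi1 T} (hg : g = g') :
    (⟨i, (g : 𝒢.Pi1 T ⧸ K i)⟩ : Σ i, 𝒢.Pi1 T ⧸ K i) = ⟨j, (g' : 𝒢.Pi1 T ⧸ K j)⟩ := by
  subst hij hg; rfl

/-- The universal Bass–Serre graph of a graph of groups: its vertices are the cosets `g 𝒢_x`,
its edges are the cosets `g 𝒢_e`, where `𝒢_e` is viewed in `𝒢_{t(e)}`; the terminus of `g 𝒢_e`
is `g 𝒢_{t(e)}`, its origin is `g e⁻¹ 𝒢_{o(e)}`, its inverse is `g e⁻¹ 𝒢_ē`. -/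
def bassSerreGraph : SerreGraph where
  V := Σ x : Λ.V, 𝒢.Pi1 T ⧸ 𝒢.vertImage T x
  E := Σ e : Λ.E, 𝒢.Pi1 T ⧸ 𝒢.edgeImage T e
  o p := ⟨Λ.o p.1, 𝒢.cosetShift T p.1 _ (fun _ => 𝒢.conj_mem_vertImage T p.1) p.2⟩
  t p := ⟨Λ.t p.1, Subgroup.quotientMapOfLE (𝒢.edgeImage_le T p.1) p.2⟩
  inv p := ⟨Λ.inv p.1, 𝒢.cosetShift T p.1 _ (fun _ => 𝒢.conj_mem_edgeImage T p.1) p.2⟩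
  inv_inv := by
    rintro ⟨e, q⟩
    induction q using QuotientGroup.induction_on with
    | H g => exact 𝒢.sigma_mk_eq T _ (Λ.inv_inv e) (by simp [ofEdge_inv])
  inv_ne p h := Λ.inv_ne p.1 (congrArg Sigma.fst h)
  o_inv := by
    rintro ⟨e, q⟩
    induction q using QuotientGroup.induction_on with
    | H g => exact 𝒢.sigma_mk_eq T _ (Λ.o_inv e) (by simp [ofEdge_inv])

/-! #### Topology -/

/-- All vertex and edge groups are totally disconnected and locally compact, and the inclusions
of edge groups into vertex groups are continuous and open. -/
def IsTDLC [TopologicalSpace H] : Prop :=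
  (∀ x, TotallyDisconnectedSpace (𝒢.vert x) ∧ LocallyCompactSpace (𝒢.vert x)) ∧
  (∀ e, TotallyDisconnectedSpace (𝒢.edge e) ∧ LocallyCompactSpace (𝒢.edge e)) ∧
  ∀ e, Continuous (Subgroup.inclusion (𝒢.edge_le e)) ∧
    IsOpenMap (Subgroup.inclusion (𝒢.edge_le e))

/-- The topology on the fundamental group generated by the left cosets of the open subgroups
of the vertex groups. -/
instance [TopologicalSpace H] : TopologicalSpace (𝒢.Pi1 T) :=
  .generateFrom {A | ∃ (g : 𝒢.Pi1 T) (x : Λ.V) (U : OpenSubgroup (𝒢.vert x)),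
    A = (fun a => g * 𝒢.ofVert T x a) '' U}

end GraphOfSubgroups

/-! ### Coxeter groups and visual decompositions -/

namespace CoxeterSystem

variable {B : Type*} {M : CoxeterMatrix B} {W : Type*} [Group W] (cs : CoxeterSystem M W)

/-- The special subgroup `W_J`. -/
def special (J : Set B) : Subgroup W :=
  Subgroup.closure (cs.simple '' J)

theorem special_mono {J K : Set B} (h : J ⊆ K) : cs.special J ≤ cs.special K :=
  Subgroup.closure_mono (Set.image_mono h)

end CoxeterSystem

/-- The subsets `S_λ` of the generating set defining a graph of special subgroups based
on `Λ`. -/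
structure SpecialData (Λ : SerreGraph.{u, v}) (B : Type w) where
  vert : Λ.V → Set B
  edge : Λ.E → Set B
  edge_inv : ∀ e, edge (Λ.inv e) = edge e
  edge_subset : ∀ e, edge e ⊆ vert (Λ.t e)

namespace SpecialData

variable {Λ : SerreGraph.{u, v}} {B : Type w} (D : SpecialData Λ B)

theorem edge_subset_o (e : Λ.E) : D.edge e ⊆ D.vert (Λ.o e) := by
  have h := D.edge_subset (Λ.inv e)
  rwa [D.edge_inv, Λ.t_inv] at h

variable {M : CoxeterMatrix B} {W : Type*} [Group W] (cs : CoxeterSystem M W)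

/-- The graph of special subgroups `W_{S_λ}`. -/
def graphOfSpecial : GraphOfSubgroups Λ W where
  vert x := cs.special (D.vert x)
  edge e := cs.special (D.edge e)
  edge_inv e := by rw [D.edge_inv]
  edge_le e := cs.special_mono (D.edge_subset e)

/-- A visual graph of groups decomposition of `(W, S)`: `Λ` is connected and the homomorphism
from the fundamental group to `W` induced by the inclusions is an isomorphism. -/
def IsVisualDecomposition : Prop :=
  Λ.IsConnected ∧ ∃ T : Set Λ.E, Λ.IsMaximalTree T ∧
    Function.Bijective ((D.graphOfSpecial cs).toAmbient T)

end SpecialData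

/-! ### Buildings -/

/-- A building of type `(W, S)` with set of chambers `C`, as a `W`-metric space. -/
structure Building {B : Type*} {M : CoxeterMatrix B} {W : Type*} [Group W]
    (cs : CoxeterSystem M W) (C : Type*) where
  δ : C → C → W
  nonempty : Nonempty C
  δ_eq_one : ∀ c d, δ c d = 1 ↔ c = d
  δ_adj : ∀ c d c' s, δ c' c = cs.simple s →
    δ c' d = cs.simple s * δ c d ∨ δ c' d = δ c d
  δ_adj_of_length : ∀ c d c' s, δ c' c = cs.simple s →
    cs.length (cs.simple s * δ c d) = cs.length (δ c d) + 1 → δ c' d = cs.simple s * δ c d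
  exists_adj : ∀ c d s, ∃ c', δ c' c = cs.simple s ∧ δ c' d = cs.simple s * δ c d

namespace Building

variable {B : Type*} {M : CoxeterMatrix B} {W : Type*} [Group W] {cs : CoxeterSystem M W}
  {C : Type*} (Δ : Building cs C)

/-- The `J`-residue centred at `c`. -/
def res (J : Set B) (c : C) : Set C :=
  {d | Δ.δ c d ∈ cs.special J}

theorem mem_res_self (J : Set B) (c : C) : c ∈ Δ.res J c := by
  change Δ.δ c c ∈ cs.special J
  rw [(Δ.δ_eq_one c c).2 rfl]
  exact one_mem _

theorem δ_mem_iff_of_adj {J : Set B} {s : B} (hs : s ∈ J) {c c' : C}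
    (h : Δ.δ c' c = cs.simple s) (x : C) :
    Δ.δ c' x ∈ cs.special J ↔ Δ.δ c x ∈ cs.special J := by
  have hs' : cs.simple s ∈ cs.special J := Subgroup.subset_closure ⟨s, hs, rfl⟩
  rcases Δ.δ_adj c x c' s h with h | h <;> rw [h]
  exact Subgroup.mul_mem_cancel_left _ hs'

theorem res_eq_of_mem {J : Set B} {c d : C} (h : d ∈ Δ.res J c) : Δ.res J c = Δ.res J d := by
  have key : ∀ w ∈ cs.special J, ∀ c, Δ.δ c d = w⁻¹ → Δ.res J c = Δ.res J d := by
    intro w hw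
    induction hw using Subgroup.closure_induction_right with
    | one =>
      intro c hc
      rw [(Δ.δ_eq_one c d).1 (by simpa using hc)]
    | mul_right w _ y hy ih =>
      intro c hc
      obtain ⟨s, hs, rfl⟩ := hy
      obtain ⟨c', h1, h2⟩ := Δ.exists_adj c d s
      rw [← ih c' (by rw [h2, hc]; simp)]
      exact Set.ext fun x => (Δ.δ_mem_iff_of_adj hs h1 x).symm
    | mul_inv_cancel w _ y hy ih =>
      intro c hc
      obtain ⟨s, hs, rfl⟩ := hy
      obtain ⟨c', h1, h2⟩ := Δ.exists_adj c d s
      rw [← ih c' (by rw [h2, hc]; simp)]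
      exact Set.ext fun x => (Δ.δ_mem_iff_of_adj hs h1 x).symm
  exact key (Δ.δ c d)⁻¹ (inv_mem h) c (by simp)

/-- The set of all `J`-residues. -/
def residues (J : Set B) : Set (Set C) :=
  Set.range (Δ.res J)

/-- The map from `J`-residues to `K`-residues, for `J ⊆ K`, that sends the `J`-residue of `c`
to the `K`-residue of `c`. -/
def resMap {J K : Set B} (h : J ⊆ K) (R : Δ.residues J) : Δ.residues K :=
  ⟨⋃ c ∈ R.1, Δ.res K c, by
    obtain ⟨_, c, rfl⟩ := R
    refine ⟨c, subset_antisymm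
      (Set.subset_iUnion₂ (s := fun c _ => Δ.res K c) c (Δ.mem_res_self J c))
      (Set.iUnion₂_subset fun d hd => ?_)⟩
    rw [Δ.res_eq_of_mem (cs.special_mono h hd : d ∈ Δ.res K c)]⟩

theorem resMap_res {J K : Set B} (h : J ⊆ K) (c : C) :
    (Δ.resMap h ⟨Δ.res J c, Set.mem_range_self c⟩).1 = Δ.res K c := by
  refine subset_antisymm (Set.iUnion₂_subset fun d hd => ?_)
    (Set.subset_iUnion₂ (s := fun c _ => Δ.res K c) c (Δ.mem_res_self J c))
  rw [Δ.res_eq_of_mem (cs.special_mono h hd : d ∈ Δ.res K c)]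

theorem sigma_residue_eq {ι : Type*} (S : ι → Set B) {i j : ι} (hij : i = j)
    {R : Δ.residues (S i)} {R' : Δ.residues (S j)} (hR : R.1 = R'.1) :
    (⟨i, R⟩ : Σ i, Δ.residues (S i)) = ⟨j, R'⟩ := by
  subst hij
  rw [Subtype.ext hR]

theorem residues_inv {Λ : SerreGraph.{u, v}} (D : SpecialData Λ B) (e : Λ.E) {R : Set C}
    (hR : R ∈ Δ.residues (D.edge e)) : R ∈ Δ.residues (D.edge (Λ.inv e)) := by
  rwa [D.edge_inv]

theorem resMap_val_congr {J J' K K' : Set B} (h : J ⊆ K) (h' : J' ⊆ K') (hK : K = K')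
    (R : Δ.residues J) (R' : Δ.residues J') (hR : R.1 = R'.1) :
    (Δ.resMap h R).1 = (Δ.resMap h' R').1 := by
  subst hK
  simp only [resMap, hR]

/-- The residue graph of a building with respect to a graph of special subgroups. -/
def residueGraph {Λ : SerreGraph.{u, v}} (D : SpecialData Λ B) : SerreGraph where
  V := Σ x : Λ.V, Δ.residues (D.vert x)
  E := Σ e : Λ.E, Δ.residues (D.edge e)
  o p := ⟨Λ.o p.1, Δ.resMap (D.edge_subset_o p.1) p.2⟩
  t p := ⟨Λ.t p.1, Δ.resMap (D.edge_subset p.1) p.2⟩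
  inv p := ⟨Λ.inv p.1, p.2.1, Δ.residues_inv D p.1 p.2.2⟩
  inv_inv p := Δ.sigma_residue_eq D.edge (Λ.inv_inv p.1) rfl
  inv_ne p h := Λ.inv_ne p.1 (congrArg Sigma.fst h)
  o_inv p := Δ.sigma_residue_eq D.vert (Λ.o_inv p.1)
    (Δ.resMap_val_congr _ _ (congrArg D.vert (Λ.o_inv p.1)) _ _ rfl)

/-! #### Groups acting on buildings -/

/-- The group of type-preserving automorphisms: the surjective `W`-isometries. -/
def aut₀ : Subgroup (Equiv.Perm C) where
  carrier := {g | ∀ c d, Δ.δ (g c) (g d) = Δ.δ c d}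
  one_mem' _ _ := rfl
  mul_mem' hg hh c d := (hg _ _).trans (hh c d)
  inv_mem' {g} hg c d := by simpa using (hg (g⁻¹ c) (g⁻¹ d)).symm

/-- The permutation topology on the group of type-preserving automorphisms, generated by the
left cosets of the pointwise stabilisers of finite sets of chambers. -/
instance : TopologicalSpace Δ.aut₀ :=
  .generateFrom {A | ∃ (g : Δ.aut₀) (F : Finset C), A = {h | ∀ c ∈ F, h.1 c = g.1 c}}

variable {G : Type*} [Group G] (φ : G →* Δ.aut₀)

/-- The setwise stabiliser of a set of chambers. -/
def setStabiliser (R : Set C) : Subgroup G where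
  carrier := {g | (φ g).1 '' R = R}
  one_mem' := by simp
  mul_mem' {g h} hg hh := by
    simp only [Set.mem_ofPred_eq] at hg hh ⊢
    calc (φ (g * h)).1 '' R = (φ g).1 '' ((φ h).1 '' R) := by
          rw [map_mul, Subgroup.coe_mul, Equiv.Perm.coe_mul, Set.image_comp]
      _ = R := by rw [hh, hg]
  inv_mem' {g} hg := by
    simp only [Set.mem_ofPred_eq] at hg ⊢
    calc (φ g⁻¹).1 '' R = (φ g⁻¹).1 '' ((φ g).1 '' R) := by rw [hg]
      _ = R := by rw [← Set.image_comp, ← Equiv.Perm.coe_mul, ← Subgroup.coe_mul, ← map_mul]; simp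

theorem image_res (g : G) (J : Set B) (c : C) :
    (φ g).1 '' Δ.res J c = Δ.res J ((φ g).1 c) := by
  ext d
  obtain ⟨d, rfl⟩ := (φ g).1.surjective d
  rw [(φ g).1.injective.mem_set_image]
  simp only [res, Set.mem_ofPred_eq, (φ g).2 c d]

theorem setStabiliser_mono {J K : Set B} (h : J ⊆ K) (c : C) :
    Δ.setStabiliser φ (Δ.res J c) ≤ Δ.setStabiliser φ (Δ.res K c) := by
  intro g hg
  change _ '' _ = _ at hg ⊢
  rw [image_res] at hg ⊢
  have hm : (φ g).1 c ∈ Δ.res J c := hg ▸ Δ.mem_res_self J _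
  exact (Δ.res_eq_of_mem (cs.special_mono h hm : _ ∈ Δ.res K c)).symm

/-- The graph of the stabilisers in `G` of the residues `Res_{S_λ}(c)`, with the inclusions. -/
def stabiliserGraph {Λ : SerreGraph.{u, v}} (D : SpecialData Λ B) (c : C) :
    GraphOfSubgroups Λ G where
  vert x := Δ.setStabiliser φ (Δ.res (D.vert x) c)
  edge e := Δ.setStabiliser φ (Δ.res (D.edge e) c)
  edge_inv e := by rw [D.edge_inv]
  edge_le e := Δ.setStabiliser_mono φ (D.edge_subset e) c

end Building

/-! ### Paths in graphs, forests and trees -/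

namespace SerreGraph

section Paths

variable {X : SerreGraph.{u, v}}

/-! Everything rests on the residue graph being a forest, and no normal forms are needed. `Λ` is a
tree because an edge outside the maximal tree is a non-trivial element of the fundamental group,
surviving in ℤ (`ofEdge_ne_one`), which `W` does not see.

A graph is a forest once each edge has an integer function on the vertices that jumps across this
edge and is constant along all edges but it and its inverse (`eq_nil_of_bridges`). For `W` such
functions come from a twisted action on W × ℤ (`exists_height`): the vertex groups beyond `e` act by
left translation conjugated by a shift supported over W_{S_e}. The shift commutes with W_{S_e}, so
the universal property of π₁ = W yields an action, and the heights at the two ends of `e` differ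
exactly over W_{S_e}. These functions are left invariant under the vertex groups. Since moving to an
s-adjacent chamber multiplies δ(·, b) by s on the left or leaves it alone, they descend to residues
of the building (`residueGraph_eq_nil`).

The Bass–Serre graph of the stabilisers is connected and maps to the residue graph without creating
backtracking, so it is a tree. For an element of the kernel of π₁ → G, a reduced path from a vertex
to its translate has closed image, hence is empty; the element lies in a vertex group and is trivial
(`toAmbient_injective`). Chamber transitivity gives surjectivity (`iSup_stabiliser_eq_top`). The
stabilisers are open and G has small open subgroups by van Dantzig, so the topology of π₁ is pulled
back from G (`isInducing_toAmbient`). -/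

theorem IsPath.append {a b c : X.V} {p q : List X.E} (hp : X.IsPath a p b)
    (hq : X.IsPath b q c) : X.IsPath a (p ++ q) c := by
  induction p generalizing a with
  | nil => obtain rfl : a = b := hp; exact hq
  | cons e p ih => exact ⟨hp.1, ih hp.2⟩

/-- Images of paths under maps compatible with origin and terminus are paths. -/
theorem IsPath.map {Y : SerreGraph} (fV : X.V → Y.V) (fE : X.E → Y.E)
    (ho : ∀ e, Y.o (fE e) = fV (X.o e)) (ht : ∀ e, Y.t (fE e) = fV (X.t e))
    {a b : X.V} {p : List X.E} (hp : X.IsPath a p b) : Y.IsPath (fV a) (p.map fE) (fV b) := by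
  induction p generalizing a with
  | nil => exact congrArg fV hp
  | cons e p ih =>
    refine ⟨(ho e).trans (congrArg fV hp.1), ?_⟩
    rw [ht]
    exact ih hp.2

/-- Every path can be replaced by a path without backtracking that uses no new edges. -/
theorem IsPath.exists_isReduced {a b : X.V} {p : List X.E} (hp : X.IsPath a p b) :
    ∃ q, X.IsPath a q b ∧ X.IsReduced q ∧ ∀ e ∈ q, e ∈ p := by
  induction p generalizing a with
  | nil => exact ⟨[], hp, List.isChain_nil, fun _ h => h⟩
  | cons e p ih =>
    obtain ⟨q, hq, hr, hsub⟩ := ih hp.2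
    cases q with
    | nil =>
      exact ⟨[e], ⟨hp.1, hq⟩, List.isChain_singleton _, by simp⟩
    | cons f q =>
      by_cases hf : f = X.inv e
      · refine ⟨q, ?_, List.IsChain.tail hr, fun g hg => ?_⟩
        · have h := hq.2
          rwa [hf, X.t_inv, hp.1] at h
        · exact List.mem_cons_of_mem _ (hsub g (List.mem_cons_of_mem _ hg))
      · refine ⟨e :: f :: q, ⟨hp.1, hq⟩, List.isChain_cons_cons.2 ⟨hf, hr⟩, fun g hg => ?_⟩
        rcases List.mem_cons.1 hg with rfl | hg
        · exact List.mem_cons_self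
        · exact List.mem_cons_of_mem _ (hsub g hg)

/-- Along a path whose ends are separated by `h`, there is a first edge whose ends are. -/
theorem IsPath.exists_first_change {h : X.V → ℤ} {a b : X.V} {p : List X.E}
    (hp : X.IsPath a p b) (hab : h a ≠ h b) :
    ∃ q f r, p = q ++ f :: r ∧ X.IsPath a q (X.o f) ∧ h (X.o f) = h a ∧
      h (X.o f) ≠ h (X.t f) := by
  induction p generalizing a with
  | nil => exact absurd (congrArg h hp) hab
  | cons e p ih =>
    obtain ⟨rfl, hp⟩ := hp
    by_cases he : h (X.o e) = h (X.t e)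
    · obtain ⟨q, f, r, rfl, hq, h1, h2⟩ := ih hp (he ▸ hab)
      exact ⟨e :: q, f, r, rfl, ⟨rfl, hq⟩, h1.trans he.symm, h2⟩
    · exact ⟨[], e, p, rfl, rfl, rfl, he⟩

/-- A graph in which every edge is a bridge has no closed paths without backtracking. -/
theorem eq_nil_of_bridges
    (hb : ∀ e, ∃ h : X.V → ℤ, h (X.o e) ≠ h (X.t e) ∧
      ∀ f, f ≠ e → f ≠ X.inv e → h (X.o f) = h (X.t f))
    (a : X.V) (p : List X.E) (hp : X.IsPath a p a) (hr : X.IsReduced p) : p = [] := by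
  induction hn : p.length using Nat.strong_induction_on generalizing a p with
  | _ n ih =>
    subst hn
    cases p with
    | nil => rfl
    | cons e p =>
      exfalso
      obtain ⟨rfl, hp⟩ := hp
      obtain ⟨h, he, hf⟩ := hb e
      obtain ⟨q, f, r, rfl, hq, h1, h2⟩ := hp.exists_first_change he.symm
      obtain rfl : f = X.inv e := by
        by_contra hne
        by_cases hfe : f = e
        · exact he (hfe ▸ h1)
        · exact h2 (hf f hfe hne)
      rw [X.o_inv] at hq
      have hchain := List.isChain_append.1 (List.IsChain.tail hr : X.IsReduced (q ++ _))
      -- The excursion before the return is a shorter closed reduced path at `t e`, hence empty: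
      -- `inv e` follows `e` immediately.
      obtain rfl := ih q.length (by simp) _ q hq hchain.1 rfl
      exact (List.isChain_cons_cons.1 hr).1 rfl

/-- Otherwise reducing `p`, which brings in no new edges, and prefixing `e` would give a non-empty
closed path without backtracking. -/
theorem IsTree.inv_mem_of_isPath (hX : X.IsTree) {e : X.E} {p : List X.E}
    (hp : X.IsPath (X.t e) p (X.o e)) : X.inv e ∈ p := by
  obtain ⟨q, hq, hr, hsub⟩ := hp.exists_isReduced
  by_contra hne
  refine List.cons_ne_nil e q (hX.2 (X.o e) (e :: q) ⟨rfl, hq⟩ ?_)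
  cases q with
  | nil => exact List.isChain_singleton _
  | cons f q =>
    exact List.isChain_cons_cons.2 ⟨fun h => hne (hsub _ (h ▸ List.mem_cons_self)), hr⟩

/-- Removing an edge from a tree separates its ends. -/
theorem IsTree.exists_side (hX : X.IsTree) (e : X.E) :
    ∃ σ : X.V → Prop, σ (X.t e) ∧ ¬ σ (X.o e) ∧
      ∀ f, f ≠ e → f ≠ X.inv e → (σ (X.o f) ↔ σ (X.t f)) := by
  refine ⟨fun x => ∃ p, X.IsPath (X.t e) p x ∧ X.inv e ∉ p ∧ e ∉ p, ⟨[], rfl, by simp, by simp⟩,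
    fun ⟨p, hp, hn, _⟩ => hn (hX.inv_mem_of_isPath hp), fun f hf hf' => ⟨?_, ?_⟩⟩
  · rintro ⟨p, hp, hn, hn'⟩
    exact ⟨p ++ [f], hp.append ⟨rfl, rfl⟩, by simp [hn, hf'.symm], by simp [hn', hf.symm]⟩
  · rintro ⟨p, hp, hn, hn'⟩
    have h1 : X.inv e ≠ X.inv f := fun h => hf (by rw [← X.inv_inv f, ← h, X.inv_inv])
    have h2 : e ≠ X.inv f := fun h => hf' (by rw [h, X.inv_inv])
    exact ⟨p ++ [X.inv f], hp.append ⟨X.o_inv f, X.t_inv f⟩, by simp [hn, h1], by simp [hn', h2]⟩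

/-- The only maximal subtree of a tree is the tree itself. -/
theorem IsTree.mem_of_isMaximalTree (hX : X.IsTree) {T : Set X.E} (hT : X.IsMaximalTree T)
    (e : X.E) : e ∈ T := by
  obtain ⟨hT, hconn, -⟩ := hT
  -- A path inside `T` joining the ends of `e` is forced to use `inv e`, so `T` contains it.
  obtain ⟨p, hp⟩ := hconn.2 (X.t e) (X.o e)
  have hm := hX.inv_mem_of_isPath
    (IsPath.map (X := X.spanningSubgraph T hT) (Y := X) (fun x => x) Subtype.val
      (fun _ => rfl) (fun _ => rfl) hp)
  obtain ⟨f, -, hf⟩ := List.mem_map.1 hm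
  have h := hT _ f.2
  rwa [hf, X.inv_inv] at h

theorem IsMaximalTree.isTree {T : Set X.E} (hT : X.IsMaximalTree T) (h : ∀ e, e ∈ T) :
    X.IsTree := by
  obtain ⟨hT, ⟨hne, hconn⟩, hred⟩ := hT
  refine ⟨⟨hne, fun a b => ?_⟩, fun a p hp hr => ?_⟩
  · obtain ⟨p, hp⟩ := hconn a b
    exact ⟨_, IsPath.map (X := X.spanningSubgraph T hT) (Y := X) (fun x => x) Subtype.val
      (fun _ => rfl) (fun _ => rfl) hp⟩
  · have hp' := IsPath.map (X := X) (Y := X.spanningSubgraph T hT) (fun x => x) (fun e => ⟨e, h e⟩)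
      (fun _ => rfl) (fun _ => rfl) hp
    refine List.map_eq_nil_iff.1 (hred a _ hp' ?_)
    refine (List.isChain_map _).2 (List.IsChain.imp (fun e f hef heq => hef ?_) hr)
    exact congrArg Subtype.val heq

end Paths

end SerreGraph

/-! ### Homomorphisms from fundamental groups -/

namespace GraphOfSubgroups

section Lift

variable {Λ : SerreGraph.{u, v}} {H : Type w} [Group H] (𝒢 : GraphOfSubgroups Λ H)
  (T : Set Λ.E) {K : Type*} [Group K]

/-- The universal property of the fundamental group. -/
def lift (f : ∀ x, 𝒢.vert x →* K) (η : Λ.E → K) (hinv : ∀ e, η e * η (Λ.inv e) = 1)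
    (hconj : ∀ e (a : 𝒢.edge e), η e * f (Λ.t e) (Subgroup.inclusion (𝒢.edge_le e) a) *
      (η e)⁻¹ = f (Λ.o e) (Subgroup.inclusion (𝒢.edge_le_o e) a))
    (hT : ∀ e ∈ T, η e = 1) : 𝒢.Pi1 T →* K :=
  QuotientGroup.lift (Subgroup.normalClosure {r | 𝒢.Relator T r})
    (Monoid.Coprod.lift (Monoid.CoprodI.lift f) (FreeGroup.lift η)) fun _ h =>
    (Subgroup.normalClosure_le_normal
      (N := (Monoid.Coprod.lift (Monoid.CoprodI.lift f) (FreeGroup.lift η)).ker) fun _ hr => by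
        rcases hr with e | ⟨e, a⟩ | ⟨e, he⟩
        · simpa [preEdge, MonoidHom.mem_ker] using hinv e
        · simpa [preEdge, preVert, MonoidHom.mem_ker, mul_inv_eq_one] using hconj e a
        · simpa [preEdge, MonoidHom.mem_ker] using hT e he) h

section

variable (f : ∀ x, 𝒢.vert x →* K) (η : Λ.E → K) (hinv : ∀ e, η e * η (Λ.inv e) = 1)
    (hconj : ∀ e (a : 𝒢.edge e), η e * f (Λ.t e) (Subgroup.inclusion (𝒢.edge_le e) a) *
      (η e)⁻¹ = f (Λ.o e) (Subgroup.inclusion (𝒢.edge_le_o e) a))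
    (hT : ∀ e ∈ T, η e = 1)

theorem lift_ofVert (x : Λ.V) (a : 𝒢.vert x) :
    𝒢.lift T f η hinv hconj hT (𝒢.ofVert T x a) = f x a :=
  show Monoid.Coprod.lift (Monoid.CoprodI.lift f) (FreeGroup.lift η) (𝒢.preVert x a) = f x a by
    simp [preVert]

theorem lift_ofEdge (e : Λ.E) : 𝒢.lift T f η hinv hconj hT (𝒢.ofEdge T e) = η e :=
  show Monoid.Coprod.lift (Monoid.CoprodI.lift f) (FreeGroup.lift η) (𝒢.preEdge e) = η e by
    simp [preEdge]

end

@[simp]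
theorem toAmbient_ofVert (x : Λ.V) (a : 𝒢.vert x) : 𝒢.toAmbient T (𝒢.ofVert T x a) = a :=
  show 𝒢.preToAmbient (𝒢.preVert x a) = a by simp [preToAmbient, preVert]

@[simp]
theorem toAmbient_ofEdge (e : Λ.E) : 𝒢.toAmbient T (𝒢.ofEdge T e) = 1 :=
  show 𝒢.preToAmbient (𝒢.preEdge e) = 1 by simp [preToAmbient, preEdge]

theorem ofEdge_eq_one {e : Λ.E} (he : e ∈ T) : 𝒢.ofEdge T e = 1 :=
  𝒢.toPi1_relator T (.tree e he)

/-- The edges outside `T` are non-trivial in the fundamental group. -/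
theorem ofEdge_ne_one {e : Λ.E} (he : e ∉ T) (he' : Λ.inv e ∉ T) : 𝒢.ofEdge T e ≠ 1 := by
  classical
  -- Signed count of crossings of `e`: a homomorphism to ℤ killing the vertex groups and all other
  -- edges.
  let η : Λ.E → Multiplicative ℤ := fun f =>
    if f = e then .ofAdd 1 else if f = Λ.inv e then .ofAdd (-1) else 1
  have hη : η e = .ofAdd 1 := if_pos rfl
  have hη' : η (Λ.inv e) = .ofAdd (-1) := by simp [η, Λ.inv_ne e]
  have hinv : ∀ f, η f * η (Λ.inv f) = 1 := by
    intro f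
    by_cases h1 : f = e
    · subst h1; rw [hη, hη']; rfl
    by_cases h2 : f = Λ.inv e
    · subst h2; rw [Λ.inv_inv, hη, hη']; rfl
    have h3 : Λ.inv f ≠ e := fun h => h2 (by rw [← h, Λ.inv_inv])
    have h4 : Λ.inv f ≠ Λ.inv e := fun h => h1 (by rw [← Λ.inv_inv f, h, Λ.inv_inv])
    simp [η, h1, h2, h3, h4]
  intro h
  have := 𝒢.lift_ofEdge T (fun _ => 1) η hinv (by simp) (fun f hf => by
    have h1 : f ≠ e := fun h => he (h ▸ hf)
    have h2 : f ≠ Λ.inv e := fun h => he' (h ▸ hf)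
    simp [η, h1, h2]) e
  rw [h, map_one, hη] at this
  exact absurd (congrArg Multiplicative.toAdd this) (by simp)

/-- If the fundamental group embeds into the ambient group through the inclusions, then the
underlying graph is a tree. -/
theorem isTree_of_injective {T : Set Λ.E} (hT : Λ.IsMaximalTree T)
    (hinj : Function.Injective (𝒢.toAmbient T)) : Λ.IsTree := by
  refine hT.isTree fun e => ?_
  by_contra he
  -- An edge outside `T` would be a non-trivial element of the kernel.
  refine 𝒢.ofEdge_ne_one T he (fun h => he ?_) (hinj (by simp))
  rw [← Λ.inv_inv e]
  exact hT.1 _ h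

variable {T}

/-- If all edges are trivial, the vertex groups generate the fundamental group. -/
theorem iSup_vertImage (hT : ∀ e, e ∈ T) : ⨆ x, 𝒢.vertImage T x = ⊤ := by
  refine eq_top_iff.2 fun g _ => ?_
  obtain ⟨g, rfl⟩ : ∃ g', 𝒢.toPi1 T g' = g := QuotientGroup.mk'_surjective _ g
  induction g using Monoid.Coprod.induction_on with
  | inl g =>
    induction g using Monoid.CoprodI.induction_on with
    | one => simp only [map_one, one_mem]
    | of i m => exact Subgroup.mem_iSup_of_mem i ⟨m, rfl⟩
    | mul x y hx hy => simpa only [map_mul] using mul_mem (hx trivial) (hy trivial)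
  | inr g =>
    have h : (𝒢.toPi1 T).comp Monoid.Coprod.inr = (1 : FreeGroup Λ.E →* 𝒢.Pi1 T) :=
      FreeGroup.ext_hom _ _ fun e => 𝒢.ofEdge_eq_one T (hT e)
    have hg : 𝒢.toPi1 T (Monoid.Coprod.inr g) = 1 := DFunLike.congr_fun h g
    rw [hg]
    exact one_mem _
  | mul x y hx hy => simpa only [map_mul] using mul_mem (hx trivial) (hy trivial)

/-- Induction along products of elements of the vertex groups. -/
theorem induction_on_right (hT : ∀ e, e ∈ T) {P : 𝒢.Pi1 T → Prop} (one : P 1)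
    (mul : ∀ g x (a : 𝒢.vert x), P g → P (g * 𝒢.ofVert T x a)) (g : 𝒢.Pi1 T) : P g := by
  have hg : g ∈ Subgroup.closure (⋃ x, (𝒢.vertImage T x : Set (𝒢.Pi1 T))) := by
    rw [← Subgroup.iSup_eq_closure, 𝒢.iSup_vertImage hT]; trivial
  induction hg using Subgroup.closure_induction_right with
  | one => exact one
  | mul_right g _ y hy ih =>
    obtain ⟨x, a, rfl⟩ := Set.mem_iUnion.1 hy
    exact mul g x a ih
  | mul_inv_cancel g _ y hy ih =>
    obtain ⟨x, a, rfl⟩ := Set.mem_iUnion.1 hy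
    rw [← map_inv]
    exact mul g x a⁻¹ ih

theorem range_toAmbient (hT : ∀ e, e ∈ T) : (𝒢.toAmbient T).range = ⨆ x, 𝒢.vert x := by
  refine le_antisymm ?_ (iSup_le fun x a ha => ⟨𝒢.ofVert T x ⟨a, ha⟩, by simp⟩)
  rintro _ ⟨g, rfl⟩
  induction g using 𝒢.induction_on_right hT with
  | one => simp only [map_one, one_mem]
  | mul g x a ih =>
    rw [map_mul, toAmbient_ofVert]
    exact mul_mem ih (Subgroup.mem_iSup_of_mem x a.2)

end Lift

/-! ### Separating the Bass–Serre tree along an edge -/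

section Height

/-- The action of `H` on `H × ℤ` by left multiplication on the first factor. -/
def leftPerm (H : Type*) [Group H] : H →* Equiv.Perm (H × ℤ) where
  toFun a := (Equiv.mulLeft a).prodCongr (Equiv.refl ℤ)
  map_one' := by ext <;> simp
  map_mul' a b := by ext <;> simp [mul_assoc]

@[simp]
theorem leftPerm_apply {H : Type*} [Group H] (a : H) (z : H × ℤ) :
    leftPerm H a z = (a * z.1, z.2) := rfl

open Classical in
/-- The permutation of `H × ℤ` raising the second coordinate by one above `K`. -/
noncomputable def raise {H : Type*} [Group H] (K : Subgroup H) : Equiv.Perm (H × ℤ) :=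
  Equiv.prodShear (Equiv.refl H) fun g => Equiv.addRight (if g ∈ K then 1 else 0)

open Classical in
@[simp]
theorem raise_apply {H : Type*} [Group H] (K : Subgroup H) (z : H × ℤ) :
    raise K z = (z.1, z.2 + if z.1 ∈ K then 1 else 0) := rfl

-- Left translation by an element of `K` preserves `K`, hence the locus that is raised. This lets
-- the vertex groups on one side of an edge be twisted without altering the action of the edge
-- group.
open Classical in
theorem raise_conj_leftPerm {H : Type*} [Group H] {K : Subgroup H} {a : H} (ha : a ∈ K) :
    (raise K)⁻¹ * leftPerm H a * raise K = leftPerm H a := by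
  rw [mul_assoc, inv_mul_eq_iff_eq_mul]
  refine Equiv.ext fun z => ?_
  have h : a * z.1 ∈ K ↔ z.1 ∈ K := Subgroup.mul_mem_cancel_left K ha
  simpa using if_congr h.symm rfl rfl

variable {Λ : SerreGraph.{u, v}} {H : Type w} [Group H] (𝒢 : GraphOfSubgroups Λ H)
  {T : Set Λ.E}

open Classical in
/-- For a tree of subgroups of `H` whose fundamental group is `H`, and an edge `e`, there is an
integer valued function on the cosets of the vertex groups that is constant along all the edges
of the Bass–Serre tree but the one given by the trivial coset of the edge group of `e`. Cosets
are right cosets here. -/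
theorem exists_height (hΛ : Λ.IsTree) (hT : Λ.IsMaximalTree T)
    (hbij : Function.Bijective (𝒢.toAmbient T)) (e : Λ.E) :
    ∃ h : Λ.V → H → ℤ, (∀ x, ∀ a ∈ 𝒢.vert x, ∀ g, h x (a * g) = h x g) ∧
      (∀ f, f ≠ e → f ≠ Λ.inv e → h (Λ.o f) = h (Λ.t f)) ∧
      ∀ g, h (Λ.o e) g ≠ h (Λ.t e) g ↔ g ∈ 𝒢.edge e := by
  obtain ⟨σ, ht, ho, hσ⟩ := hΛ.exists_side e
  have hT := hΛ.mem_of_isMaximalTree hT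
  -- Vertex groups on the side of `t e` act by left translation conjugated by `τ`, the others by
  -- plain left translation.
  let τ := raise (𝒢.edge e)
  let side : Λ.V → Equiv.Perm (H × ℤ) := fun x => if σ x then τ else 1
  let f : ∀ x, 𝒢.vert x →* Equiv.Perm (H × ℤ) := fun x =>
    ((MulAut.conj (side x)⁻¹).toMonoidHom.comp (leftPerm H)).comp (𝒢.vert x).subtype
  have hf : ∀ x (a : 𝒢.vert x), f x a = (side x)⁻¹ * leftPerm H a * side x := by
    intro x a; simp [f]
  have hside : ∀ x, σ x → side x = τ := fun x hx => if_pos hx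
  have hside' : ∀ x, ¬ σ x → side x = 1 := fun x hx => if_neg hx
  have hfix : ∀ x, ∀ a ∈ 𝒢.edge e, (side x)⁻¹ * leftPerm H a * side x = leftPerm H a := by
    intro x a ha
    by_cases hx : σ x
    · rw [hside x hx]; exact raise_conj_leftPerm ha
    · simp [hside' x hx]
  -- The twist is compatible with every edge: over `e` and its inverse it is invisible on the edge
  -- group, and any other edge has both ends on the same side.
  let Θ := 𝒢.lift T f 1 (by simp) (fun d a => by
    simp only [Pi.one_apply, one_mul, inv_one, mul_one, hf, Subgroup.coe_inclusion]
    by_cases hd : d = e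
    · subst hd; rw [hfix _ _ a.2, hfix _ _ a.2]
    by_cases hd' : d = Λ.inv e
    · subst hd'
      have ha : (a : H) ∈ 𝒢.edge e := 𝒢.edge_inv e ▸ a.2
      rw [hfix _ _ ha, hfix _ _ ha]
    · have : side (Λ.t d) = side (Λ.o d) := by simp only [side, hσ d hd hd']
      rw [this]) (by simp)
  have hΘ : ∀ x (a : 𝒢.vert x), Θ (𝒢.ofVert T x a) = f x a :=
    𝒢.lift_ofVert T f 1 _ _ _
  have hτ : ∀ x z, (side x z).1 = z.1 := by
    intro x z
    by_cases hx : σ x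
    · rw [hside x hx]; rfl
    · rw [hside' x hx]; rfl
  have hτ' : ∀ x z, ((side x).symm z).1 = z.1 := by
    intro x z
    rw [← hτ x, Equiv.apply_symm_apply]
  -- On first coordinates the twist disappears; only the second coordinate carries new information.
  have hfst : ∀ p z, (Θ p z).1 = 𝒢.toAmbient T p * z.1 := by
    intro p
    induction p using 𝒢.induction_on_right hT with
    | one => simp
    | mul p x a ih =>
      intro z
      rw [map_mul, map_mul, toAmbient_ofVert, Equiv.Perm.mul_apply, ih, hΘ, hf]
      simp [hτ, hτ', mul_assoc]
  let ψ : 𝒢.Pi1 T ≃* H := MulEquiv.ofBijective (𝒢.toAmbient T) hbij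
  have hψ : ∀ g, 𝒢.toAmbient T (ψ.symm g) = g := ψ.apply_symm_apply
  have hψ' : ∀ x (a : H) (ha : a ∈ 𝒢.vert x), ψ.symm a = 𝒢.ofVert T x ⟨a, ha⟩ := by
    intro x a ha
    rw [MulEquiv.symm_apply_eq]
    exact (𝒢.toAmbient_ofVert T x ⟨a, ha⟩).symm
  -- Applying `side x` undoes the twist at `x`, so the vertex group of `x` only translates and keeps
  -- the height. At the ends of `e` the heights are read through 1 and `τ`, which differ exactly
  -- when the first coordinate `g` is in the edge group.
  refine ⟨fun x g => (side x (Θ (ψ.symm g) (1, 0))).2, fun x a ha g => ?_, fun d hd hd' => ?_,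
    fun g => ?_⟩
  · simp only []
    rw [map_mul, map_mul, hψ' x a ha, hΘ, hf]
    simp
  · have : side (Λ.o d) = side (Λ.t d) := by simp only [side, hσ d hd hd']
    simp only [this]
  · simp only [hside _ ht, hside' _ ho, τ, raise_apply, hfst, hψ]
    simp

end Height

end GraphOfSubgroups

/-! ### The residue graph of a building is a forest -/

namespace Building

section ResidueForest

variable {B : Type*} {M : CoxeterMatrix B} {W : Type*} [Group W] {cs : CoxeterSystem M W}
  {C : Type*} (Δ : Building cs C)

theorem res_eq_res_iff {J : Set B} {c d : C} : Δ.res J c = Δ.res J d ↔ d ∈ Δ.res J c :=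
  ⟨fun h => h ▸ Δ.mem_res_self J d, Δ.res_eq_of_mem⟩

/-- A relation between chambers that holds for `s`-adjacent chambers, `s ∈ J`, holds within
`J`-residues. -/
theorem rel_of_mem_res {J : Set B} {r : C → C → Prop} (hr : Equivalence r)
    (hadj : ∀ s ∈ J, ∀ c d, Δ.δ c d = cs.simple s → r c d) {c d : C} (h : d ∈ Δ.res J c) :
    r c d := by
  have key : ∀ w ∈ cs.special J, ∀ c, Δ.δ c d = w → r c d := by
    intro w hw
    induction hw using Subgroup.closure_induction_left with
    | one =>
      intro c hc
      rw [(Δ.δ_eq_one c d).1 hc]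
      exact hr.refl d
    | mul_left x hx y _ ih =>
      intro c hc
      obtain ⟨s, hs, rfl⟩ := hx
      -- `c'` is the next chamber of a gallery from `c` to `d` whose type spells `w`; the word need
      -- not be reduced.
      obtain ⟨c', h1, h2⟩ := Δ.exists_adj c d s
      exact hr.trans (hr.symm (hadj s hs _ _ h1)) (ih c' (by rw [h2, hc]; simp))
    | inv_mul_cancel x hx y _ ih =>
      intro c hc
      obtain ⟨s, hs, rfl⟩ := hx
      obtain ⟨c', h1, h2⟩ := Δ.exists_adj c d s
      exact hr.trans (hr.symm (hadj s hs _ _ h1)) (ih c' (by rw [h2, hc]; simp))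
  exact key _ h c rfl

/-- Functions invariant under left multiplication by `W_J` give functions on `J`-residues. -/
theorem apply_δ_eq_of_res_eq {J : Set B} {β : Type*} {f : W → β}
    (hf : ∀ a ∈ cs.special J, ∀ w, f (a * w) = f w) (b : C) {c d : C}
    (h : Δ.res J c = Δ.res J d) : f (Δ.δ c b) = f (Δ.δ d b) := by
  refine Δ.rel_of_mem_res (r := fun c d => f (Δ.δ c b) = f (Δ.δ d b))
    ⟨fun _ => rfl, Eq.symm, Eq.trans⟩ (fun s hs c d hcd => ?_) (Δ.res_eq_res_iff.1 h)
  -- Both possible values of δ are harmless for a left invariant `f`, so it does not matter which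
  -- one occurs.
  rcases Δ.δ_adj d b c s hcd with h | h
  · simp only [h]
    exact hf _ (Subgroup.subset_closure ⟨s, hs, rfl⟩) _
  · simp only [h]

variable {Λ : SerreGraph.{u, v}} (D : SpecialData Λ B)

theorem residueGraph_o (e : Λ.E) (c : C) :
    (Δ.residueGraph D).o ⟨e, Δ.res (D.edge e) c, Set.mem_range_self c⟩ =
      ⟨Λ.o e, Δ.res (D.vert (Λ.o e)) c, Set.mem_range_self c⟩ :=
  Δ.sigma_residue_eq D.vert rfl (Δ.resMap_res _ c)

theorem residueGraph_t (e : Λ.E) (c : C) :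
    (Δ.residueGraph D).t ⟨e, Δ.res (D.edge e) c, Set.mem_range_self c⟩ =
      ⟨Λ.t e, Δ.res (D.vert (Λ.t e)) c, Set.mem_range_self c⟩ :=
  Δ.sigma_residue_eq D.vert rfl (Δ.resMap_res _ c)

theorem residueGraph_inv (e : Λ.E) (c : C) :
    (Δ.residueGraph D).inv ⟨e, Δ.res (D.edge e) c, Set.mem_range_self c⟩ =
      ⟨Λ.inv e, Δ.res (D.edge (Λ.inv e)) c, Set.mem_range_self c⟩ :=
  Δ.sigma_residue_eq D.edge rfl (by simp only [D.edge_inv])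

/-- The residue graph with respect to a visual decomposition has no closed paths without
backtracking. -/
theorem residueGraph_eq_nil {T : Set Λ.E} (hΛ : Λ.IsTree) (hT : Λ.IsMaximalTree T)
    (hbij : Function.Bijective ((D.graphOfSpecial cs).toAmbient T))
    (a : (Δ.residueGraph D).V) (p : List (Δ.residueGraph D).E)
    (hp : (Δ.residueGraph D).IsPath a p a) (hr : (Δ.residueGraph D).IsReduced p) : p = [] := by
  refine SerreGraph.eq_nil_of_bridges ?_ a p hp hr
  rintro ⟨e, _, b, rfl⟩
  obtain ⟨h, hinv, hne, he⟩ := (D.graphOfSpecial cs).exists_height hΛ hT hbij e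
  -- The height of the Weyl distance to `b`; by left invariance the chosen chamber of the residue is
  -- irrelevant.
  let k : (Δ.residueGraph D).V → ℤ := fun q => h q.1 (Δ.δ q.2.2.choose b)
  have hk : ∀ x c, k ⟨x, Δ.res (D.vert x) c, Set.mem_range_self c⟩ = h x (Δ.δ c b) := by
    intro x c
    exact Δ.apply_δ_eq_of_res_eq (hinv x) b
      (Set.mem_range_self (f := Δ.res (D.vert x)) c).choose_spec
  have hmem : ∀ c, h (Λ.o e) (Δ.δ c b) ≠ h (Λ.t e) (Δ.δ c b) ↔
      Δ.res (D.edge e) c = Δ.res (D.edge e) b := fun c =>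
    (he _).trans Δ.res_eq_res_iff.symm
  refine ⟨k, ?_, ?_⟩
  · rw [residueGraph_o, residueGraph_t, hk, hk]
    exact (hmem b).2 rfl
  · rintro ⟨f, _, c, rfl⟩ h1 h2
    rw [residueGraph_o, residueGraph_t, hk, hk]
    by_cases hf : f = e
    · subst hf
      by_contra hcon
      exact h1 (Δ.sigma_residue_eq D.edge rfl ((hmem c).1 hcon))
    by_cases hf' : f = Λ.inv e
    · subst hf'
      rw [Λ.o_inv, Λ.t_inv]
      by_contra hcon
      refine h2 (Eq.trans ?_ (Δ.residueGraph_inv D e b).symm)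
      refine Δ.sigma_residue_eq D.edge rfl ?_
      simp only [D.edge_inv]
      exact (hmem c).1 (Ne.symm hcon)
    · rw [hne f hf hf']

end ResidueForest

/-! ### Chamber transitive actions -/

section Action

variable {B : Type*} {M : CoxeterMatrix B} {W : Type*} [Group W] {cs : CoxeterSystem M W}
  {C : Type*} (Δ : Building cs C) {G : Type*} [Group G] (φ : G →* Δ.aut₀)

theorem mem_setStabiliser_res {J : Set B} {c : C} {g : G} :
    g ∈ Δ.setStabiliser φ (Δ.res J c) ↔ Δ.res J ((φ g).1 c) = Δ.res J c := by
  rw [← Δ.image_res φ]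
  rfl

/-- Translating back by `g` reduces to the definition of the stabiliser. This dictionary makes the
map from cosets to residues well defined and injective. -/
theorem res_apply_eq_iff {J : Set B} {c : C} {g g' : G} :
    Δ.res J ((φ g).1 c) = Δ.res J ((φ g').1 c) ↔ g⁻¹ * g' ∈ Δ.setStabiliser φ (Δ.res J c) := by
  have h : (φ g').1 c = (φ g).1 ((φ (g⁻¹ * g')).1 c) := by
    rw [← Equiv.Perm.mul_apply, ← Subgroup.coe_mul, ← map_mul, mul_inv_cancel_left]
  rw [mem_setStabiliser_res, h, ← Δ.image_res φ, ← Δ.image_res φ g,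
    (φ g).1.injective.image_injective.eq_iff]
  exact eq_comm

variable {Λ : SerreGraph.{u, v}} (D : SpecialData Λ B)

/-- The stabilisers of residues of the types of a visual decomposition generate a chamber
transitive group. -/
theorem iSup_stabiliser_eq_top (htrans : ∀ c d : C, ∃ g : G, (φ g).1 c = d) (c : C)
    [Nonempty Λ.V] (hgen : ⨆ x, cs.special (D.vert x) = ⊤) :
    ⨆ x, (Δ.stabiliserGraph φ D c).vert x = ⊤ := by
  set K := ⨆ x, (Δ.stabiliserGraph φ D c).vert x
  have hK : ∀ x, Δ.setStabiliser φ (Δ.res (D.vert x) c) ≤ K :=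
    le_iSup (fun x => (Δ.stabiliserGraph φ D c).vert x)
  have hres : ∀ x g g', Δ.res (D.vert x) ((φ g).1 c) = Δ.res (D.vert x) ((φ g').1 c) →
      g ∈ K → g' ∈ K := fun x g g' h hg =>
    (Subgroup.mul_mem_cancel_left K (inv_mem hg)).1 (hK x ((Δ.res_apply_eq_iff φ).1 h))
  refine eq_top_iff.2 fun g _ => ?_
  have htop : cs.special (⋃ x, D.vert x) = ⊤ := by
    rw [← hgen, CoxeterSystem.special, Set.image_iUnion, Subgroup.closure_iUnion]
    rfl
  -- Whether an element lies in `K` is to be shown constant along galleries. Reflexivity already has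
  -- content: the chamber stabiliser lies in `K`, because it lies in the stabiliser of a residue and
  -- there is at least one vertex.
  let r : C → C → Prop := fun d d' => ∀ g g', (φ g).1 c = d → (φ g').1 c = d' → (g ∈ K ↔ g' ∈ K)
  have hr : r c ((φ g).1 c) := by
    refine Δ.rel_of_mem_res (J := ⋃ x, D.vert x) ⟨?_, ?_, ?_⟩ ?_
      (show Δ.δ _ _ ∈ cs.special _ by rw [htop]; trivial)
    · rintro d g g' rfl h
      obtain ⟨x⟩ := ‹Nonempty Λ.V›
      exact ⟨hres x g g' (by rw [h]), hres x g' g (by rw [h])⟩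
    · exact fun h g g' hg hg' => (h g' g hg' hg).symm
    · intro d d' d'' h h' g g' hg hg'
      -- Without an element carrying `c` to the middle chamber, the relations would not compose.
      obtain ⟨k, hk⟩ := htrans c d'
      exact (h g k hg hk).trans (h' k g' hk hg')
    · rintro s hs d d' hdd g g' rfl rfl
      obtain ⟨x, hx⟩ := Set.mem_iUnion.1 hs
      have h := Δ.res_eq_of_mem (J := D.vert x) (c := (φ g).1 c) (d := (φ g').1 c) (by
        change Δ.δ _ _ ∈ cs.special _
        rw [hdd]
        exact Subgroup.subset_closure ⟨s, hx, rfl⟩)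
      exact ⟨hres x g g' h, hres x g' g h.symm⟩
  exact (hr 1 g (by simp) rfl).1 (one_mem K)

end Action

end Building

/-! ### Reduced paths under locally injective maps -/

namespace SerreGraph

/-- Backtracking concerns consecutive edges only, so the condition on `fE` is needed only for edges
that meet. -/
theorem IsReduced.map {X : SerreGraph.{u, v}} {Y : SerreGraph} {fE : X.E → Y.E}
    (hloc : ∀ e f, X.t e = X.o f → fE f = Y.inv (fE e) → f = X.inv e) {a b : X.V}
    {p : List X.E} (hr : X.IsReduced p) (hp : X.IsPath a p b) : Y.IsReduced (p.map fE) := by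
  induction p generalizing a with
  | nil => exact List.isChain_nil
  | cons e p ih =>
    have h := ih (List.IsChain.tail hr) hp.2
    cases p with
    | nil => exact List.isChain_singleton _
    | cons f p =>
      exact List.isChain_cons_cons.2
        ⟨fun hf => (List.isChain_cons_cons.1 hr).1 (hloc e f hp.2.1.symm hf), h⟩

end SerreGraph

/-! ### The Bass–Serre graph of a tree of groups -/

namespace GraphOfSubgroups

section BassSerre

variable {Λ : SerreGraph.{u, v}} {H : Type w} [Group H] (𝒢 : GraphOfSubgroups Λ H)
  {T : Set Λ.E}

theorem toAmbient_mem_of_mem_vertImage {x : Λ.V} {g : 𝒢.Pi1 T} (hg : g ∈ 𝒢.vertImage T x) :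
    𝒢.toAmbient T g ∈ 𝒢.vert x := by
  obtain ⟨a, rfl⟩ := hg
  simp

theorem toAmbient_mem_of_mem_edgeImage {e : Λ.E} {g : 𝒢.Pi1 T} (hg : g ∈ 𝒢.edgeImage T e) :
    𝒢.toAmbient T g ∈ 𝒢.edge e := by
  obtain ⟨a, rfl⟩ := hg
  simp

/-- A single vertex group is always faithfully seen in the ambient group. No injectivity on the
whole fundamental group enters, so this can serve to prove it. -/
theorem mem_edgeImage_of_mem_vertImage {e : Λ.E} {g : 𝒢.Pi1 T}
    (hg : g ∈ 𝒢.vertImage T (Λ.t e)) (h : 𝒢.toAmbient T g ∈ 𝒢.edge e) :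
    g ∈ 𝒢.edgeImage T e := by
  obtain ⟨a, rfl⟩ := hg
  rw [toAmbient_ofVert] at h
  exact ⟨⟨a, h⟩, rfl⟩

theorem mem_vertImage_of_toAmbient_mem (hinj : Function.Injective (𝒢.toAmbient T)) {x : Λ.V}
    {g : 𝒢.Pi1 T} (h : 𝒢.toAmbient T g ∈ 𝒢.vert x) : g ∈ 𝒢.vertImage T x :=
  ⟨⟨_, h⟩, hinj (by simp)⟩

theorem sigma_mk_eq_iff {ι : Type*} (K : ι → Subgroup (𝒢.Pi1 T)) {i j : ι} {g g' : 𝒢.Pi1 T} :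
    (⟨i, (g : 𝒢.Pi1 T ⧸ K i)⟩ : Σ i, 𝒢.Pi1 T ⧸ K i) = ⟨j, (g' : 𝒢.Pi1 T ⧸ K j)⟩ ↔
      i = j ∧ g⁻¹ * g' ∈ K i := by
  constructor
  · intro h
    obtain rfl : i = j := congrArg Sigma.fst h
    exact ⟨rfl, QuotientGroup.eq.1 (eq_of_heq (Sigma.mk.inj_iff.1 h).2)⟩
  · rintro ⟨rfl, h⟩
    rw [QuotientGroup.eq.2 h]

/-- Edges in `T` are trivial in the fundamental group, so the shift by `e⁻¹` disappears. -/
theorem bassSerreGraph_o (hT : ∀ e, e ∈ T) (e : Λ.E) (g : 𝒢.Pi1 T) :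
    (𝒢.bassSerreGraph T).o ⟨e, QuotientGroup.mk g⟩ = ⟨Λ.o e, QuotientGroup.mk g⟩ :=
  𝒢.sigma_mk_eq T _ rfl (by simp [𝒢.ofEdge_eq_one T (hT e)])

theorem bassSerreGraph_inv (hT : ∀ e, e ∈ T) (e : Λ.E) (g : 𝒢.Pi1 T) :
    (𝒢.bassSerreGraph T).inv ⟨e, QuotientGroup.mk g⟩ = ⟨Λ.inv e, QuotientGroup.mk g⟩ :=
  𝒢.sigma_mk_eq T _ rfl (by simp [𝒢.ofEdge_eq_one T (hT e)])

theorem edgeImage_le_edgeImage_inv (hT : ∀ e, e ∈ T) (e : Λ.E) :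
    𝒢.edgeImage T e ≤ 𝒢.edgeImage T (Λ.inv e) := by
  intro g hg
  simpa [𝒢.ofEdge_eq_one T (hT e)] using 𝒢.conj_mem_edgeImage T e hg

/-- Each translate of `Λ` is connected, the translates by `g` and `g * a` share a vertex over `y`
when `a` is in the vertex group of `y`, and the vertex groups generate. -/
theorem bassSerreGraph_isConnected (hT : ∀ e, e ∈ T) (hΛ : Λ.IsConnected) :
    (𝒢.bassSerreGraph T).IsConnected := by
  have hmove : ∀ (g : 𝒢.Pi1 T) (x y : Λ.V), ∃ p, (𝒢.bassSerreGraph T).IsPath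
      ⟨x, QuotientGroup.mk g⟩ p ⟨y, QuotientGroup.mk g⟩ := fun g x y =>
    have ⟨p, hp⟩ := hΛ.2 x y
    ⟨_, hp.map (Y := 𝒢.bassSerreGraph T) (fun x => ⟨x, QuotientGroup.mk g⟩)
      (fun e => ⟨e, QuotientGroup.mk g⟩) (fun e => 𝒢.bassSerreGraph_o hT e g) fun _ => rfl⟩
  have key : ∀ (x : Λ.V) (h g : 𝒢.Pi1 T), ∃ p, (𝒢.bassSerreGraph T).IsPath
      ⟨x, QuotientGroup.mk g⟩ p ⟨x, QuotientGroup.mk (g * h)⟩ := by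
    intro x h
    induction h using 𝒢.induction_on_right hT with
    | one => exact fun g => ⟨[], 𝒢.sigma_mk_eq T _ rfl (by simp)⟩
    | mul h y a ih =>
      intro g
      obtain ⟨p, hp⟩ := ih g
      obtain ⟨q, hq⟩ := hmove (g * h) x y
      obtain ⟨r, hr⟩ := hmove (g * (h * 𝒢.ofVert T y a)) y x
      have heq : (⟨y, QuotientGroup.mk (g * h)⟩ : (𝒢.bassSerreGraph T).V) =
          ⟨y, QuotientGroup.mk (g * (h * 𝒢.ofVert T y a))⟩ :=
        (𝒢.sigma_mk_eq_iff (𝒢.vertImage T)).2 ⟨rfl, a, by group⟩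
      exact ⟨p ++ (q ++ r), hp.append (hq.append (heq ▸ hr))⟩
  refine ⟨⟨hΛ.1.some, QuotientGroup.mk 1⟩, ?_⟩
  rintro ⟨x, q⟩ ⟨y, q'⟩
  induction q using QuotientGroup.induction_on with | H g => ?_
  induction q' using QuotientGroup.induction_on with | H g' => ?_
  obtain ⟨p, hp⟩ := key x (g⁻¹ * g') g
  obtain ⟨r, hr⟩ := hmove g' x y
  rw [mul_inv_cancel_left] at hp
  exact ⟨p ++ r, hp.append hr⟩

end BassSerre

/-! ### The topology of the fundamental group -/

section Topology

variable {Λ : SerreGraph.{u, v}} {H : Type w} [Group H] (𝒢 : GraphOfSubgroups Λ H)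
  {T : Set Λ.E} [TopologicalSpace H]

theorem isOpen_image_ofVert (g : 𝒢.Pi1 T) (x : Λ.V) (U : OpenSubgroup (𝒢.vert x)) :
    IsOpen ((fun a => g * 𝒢.ofVert T x a) '' (U : Set (𝒢.vert x))) :=
  TopologicalSpace.isOpen_generateFrom_of_mem ⟨g, x, U, rfl⟩

theorem exists_openSubgroup_vert [NonarchimedeanGroup H] (x : Λ.V) {O : Set H}
    (hO : O ∈ 𝓝 (1 : H)) :
    ∃ U : OpenSubgroup (𝒢.vert x), ∀ a ∈ U, (a : H) ∈ O := by
  obtain ⟨V, hV⟩ := NonarchimedeanGroup.is_nonarchimedean O hO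
  exact ⟨V.comap (𝒢.vert x).subtype continuous_subtype_val, fun a ha => hV ha⟩

/-- Openness of the vertex groups makes each generating coset the preimage of an open set.
Conversely, any one vertex group has open subgroups small enough to fit into a given open set. -/
theorem isInducing_toAmbient [NonarchimedeanGroup H] [Nonempty Λ.V]
    (hopen : ∀ x, IsOpen (𝒢.vert x : Set H)) (hinj : Function.Injective (𝒢.toAmbient T)) :
    Topology.IsInducing (𝒢.toAmbient T) := by
  refine ⟨le_antisymm (continuous_iff_le_induced.1 ⟨fun O hO => ?_⟩) (le_generateFrom ?_)⟩
  · refine isOpen_iff_forall_mem_open.2 fun g hg => ?_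
    obtain ⟨x⟩ := ‹Nonempty Λ.V›
    obtain ⟨U, hU⟩ := 𝒢.exists_openSubgroup_vert x
      (O := (fun h => 𝒢.toAmbient T g * h) ⁻¹' O)
      ((hO.preimage (continuous_const_mul _)).mem_nhds (by simpa using hg))
    refine ⟨_, ?_, 𝒢.isOpen_image_ofVert g x U, 1, one_mem U, by simp⟩
    rintro _ ⟨a, ha, rfl⟩
    simpa using hU a ha
  · rintro _ ⟨g, x, U, rfl⟩
    refine isOpen_induced_iff.2 ⟨(fun h => 𝒢.toAmbient T g * h) '' (Subtype.val '' (U : Set _)),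
      isOpenMap_mul_left _ _ ((hopen x).isOpenMap_subtype_val _ U.isOpen), ?_⟩
    rw [← hinj.preimage_image ((fun a => g * 𝒢.ofVert T x a) '' (U : Set (𝒢.vert x)))]
    simp only [Set.image_image, map_mul, toAmbient_ofVert]
    rfl

theorem hasBasis_nhds_one [NonarchimedeanGroup H] [Nonempty Λ.V]
    (hind : Topology.IsInducing (𝒢.toAmbient T)) :
    (𝓝 (1 : 𝒢.Pi1 T)).HasBasis (fun _ : Σ x : Λ.V, OpenSubgroup (𝒢.vert x) => True)
      (fun p => 𝒢.ofVert T p.1 '' p.2) := by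
  refine ⟨fun t => ⟨fun ht => ?_, ?_⟩⟩
  · rw [hind.nhds_eq_comap, map_one] at ht
    obtain ⟨O, hO, hOt⟩ := ht
    obtain ⟨x⟩ := ‹Nonempty Λ.V›
    obtain ⟨U, hU⟩ := 𝒢.exists_openSubgroup_vert x hO
    refine ⟨⟨x, U⟩, trivial, ?_⟩
    rintro _ ⟨a, ha, rfl⟩
    exact hOt (by simpa using hU a ha)
  · rintro ⟨⟨x, U⟩, -, h⟩
    have hU : IsOpen (𝒢.ofVert T x '' (U : Set (𝒢.vert x))) := by
      simpa using 𝒢.isOpen_image_ofVert (1 : 𝒢.Pi1 T) x U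
    exact Filter.mem_of_superset (hU.mem_nhds ⟨1, one_mem U, map_one _⟩) h

end Topology

end GraphOfSubgroups

/-- Van Dantzig's theorem: in a totally disconnected locally compact group the open subgroups
form a basis of neighbourhoods of the identity. -/
theorem NonarchimedeanGroup.of_totallyDisconnected_locallyCompact (G : Type*) [Group G]
    [TopologicalSpace G] [IsTopologicalGroup G] [TotallyDisconnectedSpace G]
    [LocallyCompactSpace G] : NonarchimedeanGroup G where
  is_nonarchimedean O hO := by
    obtain ⟨K, hK, hK1, hKO⟩ := exists_compact_subset isOpen_interior
      (mem_interior_iff_mem_nhds.2 hO)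
    obtain ⟨V, hV, h1, hVK⟩ := loc_compact_Haus_tot_disc_of_zero_dim.mem_nhds_iff.1
      (isOpen_interior.mem_nhds hK1)
    have hVc : IsCompact V := hK.of_isClosed_subset hV.1 (hVK.trans interior_subset)
    -- The required subgroup is the stabiliser of the compact open set `V` under left translation.
    -- It is open, as it contains `N` ∩ `N⁻¹`, and it lies in `V` because 1 does.
    obtain ⟨N, hN, hNV⟩ := compact_open_separated_mul_left hVc hV.2 subset_rfl
    open scoped Pointwise in
    have hmem : ((MulAction.stabilizer G V : Subgroup G) : Set G) ∈ 𝓝 (1 : G) := by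
      filter_upwards [hN, inv_mem_nhds_one G hN] with g hg hg'
      refine subset_antisymm ?_ ?_
      · exact (Set.smul_set_subset_smul hg).trans hNV
      · rw [Set.subset_smul_set_iff]
        exact (Set.smul_set_subset_smul (Set.mem_inv.1 hg')).trans hNV
    open scoped Pointwise in
    refine ⟨⟨MulAction.stabilizer G V, Subgroup.isOpen_of_mem_nhds _ hmem⟩, fun g hg => ?_⟩
    have hg' : g • (1 : G) ∈ V := by
      have : g • V = V := hg
      rw [← this]
      exact Set.smul_mem_smul_set h1
    rw [smul_eq_mul, mul_one] at hg'
    exact interior_subset (hKO (interior_subset (hVK hg')))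

/-! ### The Bass–Serre graph of the stabilisers and the residue graph -/

namespace Building

section ResidueMap

variable {B : Type*} {M : CoxeterMatrix B} {W : Type*} [Group W] {cs : CoxeterSystem M W}
  {C : Type*} (Δ : Building cs C) {G : Type*} [Group G] (φ : G →* Δ.aut₀)
  {Λ : SerreGraph.{u, v}} (D : SpecialData Λ B) {T : Set Λ.E} (c : C)

/-- The map `g K_i ↦ Res_{S_i}(g c)` from cosets to residues. -/
def cosetToResidue {ι : Type*} (S : ι → Set B)
    (K : ι → Subgroup ((Δ.stabiliserGraph φ D c).Pi1 T))
    (hK : ∀ i, ∀ g ∈ K i, (Δ.stabiliserGraph φ D c).toAmbient T g ∈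
      Δ.setStabiliser φ (Δ.res (S i) c)) :
    (Σ i, (Δ.stabiliserGraph φ D c).Pi1 T ⧸ K i) → Σ i, Δ.residues (S i) :=
  fun q => ⟨q.1, Quotient.liftOn' q.2
    (fun g => ⟨Δ.res (S q.1) ((φ ((Δ.stabiliserGraph φ D c).toAmbient T g)).1 c),
      Set.mem_range_self _⟩)
    fun g g' h => Subtype.ext ((Δ.res_apply_eq_iff φ).2 (by
      rw [← map_inv, ← map_mul]
      exact hK _ _ (QuotientGroup.leftRel_apply.1 h)))⟩

/-- Injectivity is the converse inclusion `hK'`; surjectivity is chamber transitivity. The family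
`K` is arbitrary so that vertices and edges are treated at once. -/
theorem cosetToResidue_bijective {ι : Type*} (S : ι → Set B)
    (K : ι → Subgroup ((Δ.stabiliserGraph φ D c).Pi1 T))
    (hK : ∀ i, ∀ g ∈ K i, (Δ.stabiliserGraph φ D c).toAmbient T g ∈
      Δ.setStabiliser φ (Δ.res (S i) c))
    (hK' : ∀ i g, (Δ.stabiliserGraph φ D c).toAmbient T g ∈
      Δ.setStabiliser φ (Δ.res (S i) c) → g ∈ K i)
    (hsurj : Function.Surjective ((Δ.stabiliserGraph φ D c).toAmbient T))
    (htrans : ∀ c d : C, ∃ g : G, (φ g).1 c = d) :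
    Function.Bijective (Δ.cosetToResidue φ D c S K hK) := by
  constructor
  · rintro ⟨i, q⟩ ⟨j, q'⟩ h
    obtain rfl : i = j := congrArg Sigma.fst h
    induction q using QuotientGroup.induction_on with | H g => ?_
    induction q' using QuotientGroup.induction_on with | H g' => ?_
    refine (GraphOfSubgroups.sigma_mk_eq_iff _ K).2 ⟨rfl, hK' _ _ ?_⟩
    rw [map_mul, map_inv]
    exact (Δ.res_apply_eq_iff φ).1
      (congrArg Subtype.val (eq_of_heq (Sigma.mk.inj_iff.1 h).2))
  · rintro ⟨i, _, d, rfl⟩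
    obtain ⟨g, rfl⟩ := htrans c d
    obtain ⟨g, rfl⟩ := hsurj g
    exact ⟨⟨i, QuotientGroup.mk g⟩, rfl⟩

/-- The map `g 𝒢_x ↦ Res_{S_x}(g c)` from the vertices of the Bass–Serre graph. -/
def vertToResidue : ((Δ.stabiliserGraph φ D c).bassSerreGraph T).V → (Δ.residueGraph D).V :=
  Δ.cosetToResidue φ D c D.vert _ fun _ _ h =>
    (Δ.stabiliserGraph φ D c).toAmbient_mem_of_mem_vertImage h

/-- The map `g 𝒢_e ↦ Res_{S_e}(g c)` from the edges of the Bass–Serre graph. -/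
def edgeToResidue : ((Δ.stabiliserGraph φ D c).bassSerreGraph T).E → (Δ.residueGraph D).E :=
  Δ.cosetToResidue φ D c D.edge _ fun _ _ h =>
    (Δ.stabiliserGraph φ D c).toAmbient_mem_of_mem_edgeImage h

theorem vertToResidue_o (hT : ∀ e, e ∈ T)
    (q : ((Δ.stabiliserGraph φ D c).bassSerreGraph T).E) :
    (Δ.residueGraph D).o (Δ.edgeToResidue φ D c q) =
      Δ.vertToResidue φ D c (((Δ.stabiliserGraph φ D c).bassSerreGraph T).o q) := by
  obtain ⟨e, q⟩ := q
  induction q using QuotientGroup.induction_on with | H g => ?_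
  rw [GraphOfSubgroups.bassSerreGraph_o _ hT]
  exact Δ.residueGraph_o D e _

theorem vertToResidue_t (q : ((Δ.stabiliserGraph φ D c).bassSerreGraph T).E) :
    (Δ.residueGraph D).t (Δ.edgeToResidue φ D c q) =
      Δ.vertToResidue φ D c (((Δ.stabiliserGraph φ D c).bassSerreGraph T).t q) := by
  obtain ⟨e, q⟩ := q
  induction q using QuotientGroup.induction_on with | H g => ?_
  exact Δ.residueGraph_t D e _

theorem edgeToResidue_inv (hT : ∀ e, e ∈ T)
    (q : ((Δ.stabiliserGraph φ D c).bassSerreGraph T).E) :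
    (Δ.residueGraph D).inv (Δ.edgeToResidue φ D c q) =
      Δ.edgeToResidue φ D c (((Δ.stabiliserGraph φ D c).bassSerreGraph T).inv q) := by
  obtain ⟨e, q⟩ := q
  induction q using QuotientGroup.induction_on with | H g => ?_
  rw [GraphOfSubgroups.bassSerreGraph_inv _ hT]
  exact Δ.residueGraph_inv D e _

/-- The map from the Bass–Serre graph to the residue graph creates no backtracking. -/
theorem edgeToResidue_locally_injective (hT : ∀ e, e ∈ T)
    (q q' : ((Δ.stabiliserGraph φ D c).bassSerreGraph T).E)
    (hqq' : ((Δ.stabiliserGraph φ D c).bassSerreGraph T).t q =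
      ((Δ.stabiliserGraph φ D c).bassSerreGraph T).o q')
    (h : Δ.edgeToResidue φ D c q' = (Δ.residueGraph D).inv (Δ.edgeToResidue φ D c q)) :
    q' = ((Δ.stabiliserGraph φ D c).bassSerreGraph T).inv q := by
  obtain ⟨e, q⟩ := q
  obtain ⟨f, q'⟩ := q'
  obtain rfl : f = Λ.inv e := congrArg Sigma.fst h
  induction q using QuotientGroup.induction_on with | H g => ?_
  induction q' using QuotientGroup.induction_on with | H g' => ?_
  rw [GraphOfSubgroups.bassSerreGraph_o _ hT] at hqq'
  rw [GraphOfSubgroups.bassSerreGraph_inv _ hT]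
  -- Because the two edges meet, `g⁻¹ * g'` lies in one vertex group, where equality of residues can
  -- be lifted to equality of cosets.
  have hmem := ((GraphOfSubgroups.sigma_mk_eq_iff _
    ((Δ.stabiliserGraph φ D c).vertImage T)).1 hqq').2
  have hres : Δ.res (D.edge (Λ.inv e))
      ((φ ((Δ.stabiliserGraph φ D c).toAmbient T g')).1 c) =
        Δ.res (D.edge e) ((φ ((Δ.stabiliserGraph φ D c).toAmbient T g)).1 c) :=
    congrArg Subtype.val (eq_of_heq (Sigma.mk.inj_iff.1 h).2)
  rw [D.edge_inv] at hres
  refine ((GraphOfSubgroups.sigma_mk_eq_iff _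
    ((Δ.stabiliserGraph φ D c).edgeImage T)).2 ⟨rfl, ?_⟩).symm
  refine GraphOfSubgroups.edgeImage_le_edgeImage_inv _ hT e
    (GraphOfSubgroups.mem_edgeImage_of_mem_vertImage _ hmem ?_)
  rw [map_mul, map_inv]
  exact (Δ.res_apply_eq_iff φ).1 hres.symm

/-- If the residue graph is a forest, the Bass–Serre graph is a tree. -/
theorem bassSerreGraph_isTree (hT : ∀ e, e ∈ T) (hΛ : Λ.IsConnected)
    (hforest : ∀ a p, (Δ.residueGraph D).IsPath a p a → (Δ.residueGraph D).IsReduced p → p = []) :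
    ((Δ.stabiliserGraph φ D c).bassSerreGraph T).IsTree :=
  ⟨GraphOfSubgroups.bassSerreGraph_isConnected _ hT hΛ, fun _ _ hp hr =>
    List.map_eq_nil_iff.1 (hforest _ _
      (hp.map _ _ (Δ.vertToResidue_o φ D c hT) (Δ.vertToResidue_t φ D c))
      (hr.map (Δ.edgeToResidue_locally_injective φ D c hT) hp))⟩

/-- If the residue graph is a forest, the fundamental group of the graph of stabilisers embeds
into the group. -/
theorem toAmbient_injective (hT : ∀ e, e ∈ T) (hΛ : Λ.IsConnected)
    (hforest : ∀ a p, (Δ.residueGraph D).IsPath a p a → (Δ.residueGraph D).IsReduced p → p = []) :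
    Function.Injective ((Δ.stabiliserGraph φ D c).toAmbient T) := by
  refine (injective_iff_map_eq_one _).2 fun g hg => ?_
  obtain ⟨x⟩ := hΛ.1
  obtain ⟨p, hp⟩ := (GraphOfSubgroups.bassSerreGraph_isConnected
    (Δ.stabiliserGraph φ D c) hT hΛ).2 ⟨x, QuotientGroup.mk 1⟩ ⟨x, QuotientGroup.mk g⟩
  obtain ⟨q, hq, hr, -⟩ := hp.exists_isReduced
  have hq' := hq.map _ _ (Δ.vertToResidue_o φ D c hT) (Δ.vertToResidue_t φ D c)
  -- An element of the kernel moves no residue, so the image of the path is closed; being reduced in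
  -- a forest, it is empty, and `g` lies in the vertex group of `x`.
  have hends : Δ.vertToResidue φ D c (T := T) ⟨x, QuotientGroup.mk g⟩ =
      Δ.vertToResidue φ D c ⟨x, QuotientGroup.mk 1⟩ :=
    Δ.sigma_residue_eq D.vert rfl (by
      change Δ.res _ ((φ (GraphOfSubgroups.toAmbient _ T g)).1 c) =
        Δ.res _ ((φ (GraphOfSubgroups.toAmbient _ T 1)).1 c)
      rw [hg, map_one (GraphOfSubgroups.toAmbient _ T)])
  rw [hends] at hq'
  obtain rfl := List.map_eq_nil_iff.1
    (hforest _ _ hq' (hr.map (Δ.edgeToResidue_locally_injective φ D c hT) hq))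
  obtain ⟨a, ha⟩ := ((GraphOfSubgroups.sigma_mk_eq_iff _
    ((Δ.stabiliserGraph φ D c).vertImage T)).1 hq).2
  rw [inv_one, one_mul] at ha
  subst ha
  rw [GraphOfSubgroups.toAmbient_ofVert] at hg
  obtain rfl : a = 1 := Subtype.ext hg
  exact map_one _

/-- If the fundamental group of the graph of stabilisers is the whole group, its Bass–Serre graph
is the residue graph. -/
noncomputable def bassSerreIso (hT : ∀ e, e ∈ T)
    (hbij : Function.Bijective ((Δ.stabiliserGraph φ D c).toAmbient T))
    (htrans : ∀ c d : C, ∃ g : G, (φ g).1 c = d) :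
    SerreGraph.Iso ((Δ.stabiliserGraph φ D c).bassSerreGraph T) (Δ.residueGraph D) where
  onV := Equiv.ofBijective (Δ.vertToResidue φ D c)
    (Δ.cosetToResidue_bijective φ D c _ _ _
      (fun _ _ h => GraphOfSubgroups.mem_vertImage_of_toAmbient_mem _ hbij.1 h) hbij.2 htrans)
  onE := Equiv.ofBijective (Δ.edgeToResidue φ D c)
    (Δ.cosetToResidue_bijective φ D c _ _ _
      (fun e _ h => GraphOfSubgroups.mem_edgeImage_of_mem_vertImage _
        (GraphOfSubgroups.mem_vertImage_of_toAmbient_mem _ hbij.1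
          ((Δ.stabiliserGraph φ D c).edge_le e h)) h) hbij.2 htrans)
  map_o e := (Δ.vertToResidue_o φ D c hT e).symm
  map_t e := (Δ.vertToResidue_t φ D c e).symm
  map_inv e := (Δ.edgeToResidue_inv φ D c hT e).symm

/-! ### Topology of the stabilisers -/

variable [TopologicalSpace G] [IsTopologicalGroup G]

/-- Stabilisers of residues are open. -/
theorem isOpen_setStabiliser_res (hφ : Continuous φ) (J : Set B) :
    IsOpen (Δ.setStabiliser φ (Δ.res J c) : Set G) := by
  -- The stabiliser of the single chamber `c` is open, and it fixes every residue containing `c`.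
  have hc : IsOpen {h : Δ.aut₀ | ∀ d ∈ ({c} : Finset C), h.1 d = (1 : Δ.aut₀).1 d} :=
    TopologicalSpace.isOpen_generateFrom_of_mem ⟨1, {c}, rfl⟩
  refine Subgroup.isOpen_of_mem_nhds _
    (Filter.mem_of_superset ((hc.preimage hφ).mem_nhds (x := 1) (by simp)) fun g hg => ?_)
  refine (Δ.mem_setStabiliser_res φ).2 ?_
  have hgc : (φ g).1 c = c := by simpa using hg
  rw [hgc]

theorem stabiliserGraph_isTDLC [TotallyDisconnectedSpace G] [LocallyCompactSpace G]
    (hφ : Continuous φ) : (Δ.stabiliserGraph φ D c).IsTDLC := by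
  have ho := Δ.isOpen_setStabiliser_res φ c hφ
  refine ⟨fun x => ⟨inferInstance, (ho (D.vert x)).locallyCompactSpace⟩,
    fun e => ⟨inferInstance, (ho (D.edge e)).locallyCompactSpace⟩, fun e => ?_⟩
  exact ⟨continuous_inclusion ((Δ.stabiliserGraph φ D c).edge_le e),
    ((Topology.IsOpenEmbedding.inclusion ((Δ.stabiliserGraph φ D c).edge_le e)
      ((ho (D.edge e)).preimage continuous_subtype_val)).isOpenMap)⟩

end ResidueMap

end Building

/-! ### The main theorem -/

theorem corollaryG {B : Type*} [Finite B] {M : CoxeterMatrix B} {W : Type*} [Group W]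
    (cs : CoxeterSystem M W) {C : Type*} (Δ : Building cs C)
    {Λ : SerreGraph} (D : SpecialData Λ B) (hD : D.IsVisualDecomposition cs)
    {G : Type*} [Group G] [TopologicalSpace G] [IsTopologicalGroup G]
    [TotallyDisconnectedSpace G] [LocallyCompactSpace G] [SigmaCompactSpace G]
    (φ : G →* Δ.aut₀) (hφ : Continuous φ) (htrans : ∀ c d : C, ∃ g : G, (φ g).1 c = d)
    (c : C) :
    Λ.IsTree ∧ (Δ.stabiliserGraph φ D c).IsTDLC ∧
    ∀ T : Set Λ.E, Λ.IsMaximalTree T →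
      -- the fundamental group is a topological group, and the open subgroups of the vertex
      -- groups form a basis of neighbourhoods of the identity
      IsTopologicalGroup ((Δ.stabiliserGraph φ D c).Pi1 T) ∧
      (𝓝 (1 : (Δ.stabiliserGraph φ D c).Pi1 T)).HasBasis
        (fun _ : Σ x : Λ.V, OpenSubgroup ((Δ.stabiliserGraph φ D c).vert x) => True)
        (fun p => (Δ.stabiliserGraph φ D c).ofVert T p.1 '' p.2) ∧
      -- the homomorphism to `G` induced by the inclusions is a topological isomorphism
      (∃ f : (Δ.stabiliserGraph φ D c).Pi1 T ≃ₜ* G,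
        ∀ g, f g = (Δ.stabiliserGraph φ D c).toAmbient T g) ∧
      -- the Bass–Serre graph is a tree, isomorphic to the residue graph through
      -- `g 𝒢_λ ↦ Res_{S_λ}(g c)`
      ((Δ.stabiliserGraph φ D c).bassSerreGraph T).IsTree ∧
      ∃ Φ : SerreGraph.Iso ((Δ.stabiliserGraph φ D c).bassSerreGraph T) (Δ.residueGraph D),
        (∀ (x : Λ.V) (g : (Δ.stabiliserGraph φ D c).Pi1 T),
          Φ.onV ⟨x, QuotientGroup.mk g⟩ = ⟨x, Δ.res (D.vert x)
            ((φ ((Δ.stabiliserGraph φ D c).toAmbient T g)).1 c), Set.mem_range_self _⟩) ∧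
        ∀ (e : Λ.E) (g : (Δ.stabiliserGraph φ D c).Pi1 T),
          Φ.onE ⟨e, QuotientGroup.mk g⟩ = ⟨e, Δ.res (D.edge e)
            ((φ ((Δ.stabiliserGraph φ D c).toAmbient T g)).1 c), Set.mem_range_self _⟩ := by
  obtain ⟨hconn, T₀, hT₀, hbij₀⟩ := hD
  have : Nonempty Λ.V := hconn.1
  have : NonarchimedeanGroup G := .of_totallyDisconnected_locallyCompact G
  have hΛ : Λ.IsTree := (D.graphOfSpecial cs).isTree_of_injective hT₀ hbij₀.1
  have hforest := Δ.residueGraph_eq_nil D hΛ hT₀ hbij₀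
  -- Injectivity onto `W` gave the tree and, with surjectivity, the forest; surjectivity alone says
  -- that the special subgroups of the vertices generate `W`.
  have hgen : ⨆ x, cs.special (D.vert x) = ⊤ :=
    ((D.graphOfSpecial cs).range_toAmbient (hΛ.mem_of_isMaximalTree hT₀)).symm.trans
      (MonoidHom.range_eq_top.2 hbij₀.2)
  refine ⟨hΛ, Δ.stabiliserGraph_isTDLC φ D c hφ, fun T hT => ?_⟩
  -- In a tree every maximal subtree is everything, so the result holds for each `T` and not just
  -- for the given `T₀`.
  have hT := hΛ.mem_of_isMaximalTree hT
  have hbij : Function.Bijective ((Δ.stabiliserGraph φ D c).toAmbient T) :=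
    ⟨Δ.toAmbient_injective φ D c hT hconn hforest, MonoidHom.range_eq_top.1
      (((Δ.stabiliserGraph φ D c).range_toAmbient hT).trans
        (Δ.iSup_stabiliser_eq_top φ D htrans c hgen))⟩
  have hind := (Δ.stabiliserGraph φ D c).isInducing_toAmbient
    (fun x => Δ.isOpen_setStabiliser_res φ c hφ (D.vert x)) hbij.1
  let f := MulEquiv.ofBijective _ hbij
  exact ⟨hind.topologicalGroup _, (Δ.stabiliserGraph φ D c).hasBasis_nhds_one hind,
    ⟨{ f with
        continuous_toFun := hind.continuous
        continuous_invFun := hind.continuous_iff.2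
          (continuous_id.congr fun g => (f.apply_symm_apply g).symm) }, fun _ => rfl⟩,
    Δ.bassSerreGraph_isTree φ D c hT hconn hforest,
    Δ.bassSerreIso φ D c hT hbij htrans, fun _ _ => rfl, fun _ _ => rfl⟩
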